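/- Let $X\neq\{0\}$ be a complex Banach space with open unit ball $\mathcal B$, write $\mathcal B_r=\{x\in X:\|x\|<r\}$ and $J(x)=\{x^*\in X^*:\langle x,x^*\rangle=\|x\|^2=\|x^*\|^2\}$. Two numbers $r\in(0,1]$ and $\rho>0$ are called Bloch radii for a mapping $F:\mathcal B\to X$ if every $z\in\mathcal B_\rho$ has exactly one preimage $F^{-1}(z)$ in $\mathcal B_r$ and $F^{-1}:\mathcal B_\rho\to\mathcal B_r$ is holomorphic. Let $F=I-h$, where $h:\mathcal B\to X$ is holomorphic with $h(0)=0$. Let $\theta\in\mathbb R$ with $\cos\theta\ne1$ be such that $$N(\theta):=\sup_{\|x\|<1,\;x^*\in J(x)}\operatorname{Re}\langle e^{i\theta}h(x),x^*\rangle<\infty ,$$ and put $$l(\theta):=\inf_{\|x\|=1,\;x^*\in J(x)}\operatorname{Re}\langle e^{i\theta}h'(0)x,x^*\rangle,\qquad L:=\sup_{\|x\|=1,\;x^*\in J(x)}\operatorname{Re}\langle h'(0)x,x^*\rangle,\qquad \delta:=N(\theta)-l(\theta).$$ Assume $L<1$ and $\delta>0$. Define $$\rho(r)=\frac{r}{1-r^2}\bigl((1-L)(1-r^2)-2\delta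 r(1-r\cos\theta)\bigr),\qquad Q(s)=\frac{2s(1-s\cos\theta)}{1-s^2}\,\delta,$$ $$A(s)=1-L-2Q(s),\qquad B(s)=s(1-L),\qquad \rho_s(r)=\frac{A(s)r^2+B(s)r}{s+r},$$ $$r_*=\frac{\delta-\sqrt{\delta^2+[(1-L)-2\delta\cos\theta](1-L)}}{2\delta\cos\theta-(1-L)}\quad\Bigl(r_*=\tfrac{1-L}{2\delta}\ \text{if}\ 2\delta\cos\theta=1-L\Bigr),$$ $$s_*=\frac{2\delta-\sqrt{4\delta^2-(4\delta\cos\theta-(1-L))(1-L)}}{4\delta\cos\theta-(1-L)}\quad\Bigl(s_*=\tfrac{1-L}{4\delta}\ \text{if}\ 4\delta\cos\theta=1-L\Bigr).$$ Then $r_*$ is the unique zero of $\rho$ in $(0,1)$, $s_*$ is the unique zero of $A$ in $(0,1)$, and $0<s_*<r_*<1$. Moreover: 1. For every $r\in(0,r_*)$ the numbers $r$ and $\rho(r)$ are Bloch radii for $F$. The equation $\rho'(r)=0$ has a unique solution $r_0\in(0,r_*)$, and $\rho$ attains its maximum over $(0,1)$ at $r_0$. 2. For every $s\in(0,r_*)$: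 $\rho_s$ is positive on $(0,r_*)$; $\rho_s(r)\le\rho(r)$ for all $r\in(0,s]$; $\rho_s(s)=\rho(s)$; for every $r\in(0,s]$ the numbers $r$ and $\rho_s(r)$ are Bloch radii for $F$; and the inequality $\rho_s(r)\le\rho(s)$ holds for all $r\in(0,s]$ if and only if $Q(s)\le\frac23(1-L)$. 3. The following assertions hold. (a) For $s=s_*$ the dilation coefficient is affine: $\displaystyle\frac{r}{\rho_{s_*}(r)}=\frac{s_*+r}{s_*(1-L)}$ for $r>0$. (b) If $s\in(0,s_*)$, then $\rho_s$ is strictly increasing on $(0,s]$, and hence $$\max_{r\in(0,s]}\rho_s(r)=\rho_s(s)=\rho(s)=(1-L)s-\frac{2\delta s^2(1-s\cos\theta)}{1-s^2}.$$ (c) If $s\in(s_*,r_*)$, then $$\max_{r\in(0,s]}\rho_s(r)=\begin{cases}\rho_s(r^0),&Q(s)>\frac23(1-L),\\ \rho(s),&Q(s)\le\frac23(1-L),\end{cases}\qquad r^0=\Bigl(\sqrt{\tfrac{2Q(s)}{2Q(s)-(1-L)}}-1\Bigr)s,$$ and in the first case $r^0\in(0,s)$. -/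

import Mathlib

namespace BlochRadii

noncomputable section

section NumericalRange

variable {X : Type*} [NormedAddCommGroup X] [NormedSpace ℂ X]

/-- The duality set `J(x) = {x* : ⟨x, x*⟩ = ‖x‖² = ‖x*‖²}`. -/
def J (x : X) : Set (StrongDual ℂ X) :=
  {φ | φ x = ((‖x‖ ^ 2 : ℝ) : ℂ) ∧ ‖φ‖ ^ 2 = ‖x‖ ^ 2}

/-- The set of all numbers `Re ⟨e^{iθ} f(x), x*⟩` with `x ∈ D` and `x* ∈ J(x)`. -/
def reRange (D : Set X) (θ : ℝ) (f : X → X) : Set ℝ :=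
  {t | ∃ x ∈ D, ∃ φ ∈ J x, t = (φ (Complex.exp ((θ : ℂ) * Complex.I) • f x)).re}

/-- `N(θ) = sup_{‖x‖ < 1} Re ⟨e^{iθ} h(x), x*⟩` (meaningful when the supremum is finite). -/
def upperN (h : X → X) (θ : ℝ) : ℝ :=
  sSup (reRange (Metric.ball 0 1) θ h)

/-- `L(θ) = sup_{‖x‖ = 1} Re ⟨e^{iθ} h'(0)x, x*⟩`. -/
def upperL (h : X → X) (θ : ℝ) : ℝ :=
  sSup (reRange (Metric.sphere 0 1) θ (fun x => fderiv ℂ h 0 x))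

/-- `l(θ) = inf_{‖x‖ = 1} Re ⟨e^{iθ} h'(0)x, x*⟩`. -/
def lowerL (h : X → X) (θ : ℝ) : ℝ :=
  sInf (reRange (Metric.sphere 0 1) θ (fun x => fderiv ℂ h 0 x))

/-- `r` and `ρ` are Bloch radii for a mapping `F` of the open unit ball: every `z` with `‖z‖ < ρ`
has exactly one preimage in the ball of radius `r`, and this preimage depends holomorphically
on `z`. -/
def AreBlochRadii (F : X → X) (r ρ : ℝ) : Prop :=
  0 < r ∧ r ≤ 1 ∧ 0 < ρ ∧
    ∃ g : X → X, DifferentiableOn ℂ g (Metric.ball 0 ρ) ∧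
      ∀ z ∈ Metric.ball (0 : X) ρ, g z ∈ Metric.ball (0 : X) r ∧ F (g z) = z ∧
        ∀ x ∈ Metric.ball (0 : X) r, F x = z → x = g z

end NumericalRange

/-- `ρ(r) = r / (1 - r²) · ((1 - L)(1 - r²) - δ · 2r(1 - r cos θ))`. -/
def rho (L δ θ r : ℝ) : ℝ :=
  r / (1 - r ^ 2) * ((1 - L) * (1 - r ^ 2) - δ * (2 * r * (1 - r * Real.cos θ)))

/-- The root `r_*` of `ρ` in `(0, 1)`. -/
def rStar (L δ θ : ℝ) : ℝ :=
  if 2 * δ * Real.cos θ = 1 - L then (1 - L) / (2 * δ)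
  else (δ - √(δ ^ 2 + ((1 - L) - 2 * δ * Real.cos θ) * (1 - L))) /
    (2 * δ * Real.cos θ - 1 + L)

/-- `Q(s) = 2s(1 - s cos θ) / (1 - s²) · δ`. -/
def Q (δ θ s : ℝ) : ℝ :=
  2 * s * (1 - s * Real.cos θ) / (1 - s ^ 2) * δ

/-- `A(s) = 1 - L - 2Q(s)`. -/
def A (L δ θ s : ℝ) : ℝ := 1 - L - 2 * Q δ θ s

/-- `B(s) = s(1 - L)`. -/
def B (L s : ℝ) : ℝ := s * (1 - L)

/-- `ρ_s(r) = (A(s) r² + B(s) r) / (s + r)`. -/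
def rhoS (L δ θ s r : ℝ) : ℝ :=
  (A L δ θ s * r ^ 2 + B L s * r) / (s + r)

/-- The root `s_*` of `A` in `(0, 1)`; the first case is the one where the quadratic equation
for it degenerates to a linear one. -/
def sStar (L δ θ : ℝ) : ℝ :=
  if 4 * δ * Real.cos θ = 1 - L then (1 - L) / (4 * δ)
  else (2 * δ - √(4 * δ ^ 2 - (4 * δ * Real.cos θ - (1 - L)) * (1 - L))) /
    (4 * δ * Real.cos θ - (1 - L))

/-- `r⁰ = (√(2Q / (2Q - (1 - L))) - 1) s`. -/
def rZero (L δ θ s : ℝ) : ℝ :=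
  (√(2 * Q δ θ s / (2 * Q δ θ s - (1 - L))) - 1) * s

end

end BlochRadii

/-!
On a sphere `‖x‖ = r < 1` the numerical range of `h` satisfies
`Re ⟨h(x), x*⟩ ≤ r² (L + Q(r))` (`re_apply_le`): on the complex line through a unit vector `u` the
function `f(z) = ⟨h(z u), u*⟩ / z` has `Re (e^{iθ} f) ≤ N(θ)` by the maximum principle, while
`Re (e^{iθ} f(0)) ≥ l(θ)`, so Carathéodory's inequality confines `f(z) - f(0)` to a disc whose
support function in the direction of interest is `Q(|z|)`. Hence
`Re ⟨x - h(x), x*⟩ ≥ ‖x‖ ρ(‖x‖)`, and for `‖z‖ < ρ(r)` the map `x ↦ x - h(x) - z` points outwards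
near the sphere of radius `r`.

A bounded holomorphic map `G` with this property has exactly one zero in the ball of radius `r`
(`exists_unique_zero`). For small `t > 0` the resolvent `(I + t G)⁻¹` maps a ball of radius slightly
larger than `r` into the ball of radius `r`, so the Earle–Hamilton theorem
(`exists_fixedPoint_of_mapsTo_closedBall`) gives a unique fixed point and the invertibility of `G'`
there; the inverse function theorem then makes the inverse of `I - h` holomorphic
(`areBlochRadii_of_le_re`).

In infinite dimensions a holomorphic map may be unbounded on a smaller concentric ball. For `h` this
is excluded by the bound on its numerical range (`exists_norm_le_of_numericalRange_bound`). Each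
homogeneous part `P` of degree `n ≥ 2` of `h` is bounded on bounded sets, so the result above applies
to `I - λ P`; homogeneity turns the boundedness of the inverse of `I - λ P` into a bound for `P` in
terms of its numerical range (`norm_le_of_numericalRange_bound`), and these bounds are summable on
smaller balls.

The remaining assertions are elementary. One has `ρ(r) = r (1 - L - Q(r))` and
`ρ_s(r) = r (1 - L - 2 r Q(s) / (s + r))`, where `1 - L - Q(r)` is a positive multiple of `r_* - r`
and `2 r Q(s) / (s + r) - Q(r)` is a positive multiple of `s - r`; `s_*` is `r_*` with `2 δ` in place
of `δ`; `ρ` is strictly concave by its partial fractions; and in the variable `u = s + r` the function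
`ρ_s` is, up to a constant, a combination of `u` and `1 / u`.
-/

namespace BlochRadii

/-! ### The roots of `ρ` and of `A` -/

lemma disc_pos {a δ c : ℝ} (ha : 0 < a) (hδ : 0 < δ) (hc : c < 1) :
    0 < δ ^ 2 + (a - 2 * δ * c) * a := by
  nlinarith [sq_nonneg (δ - a), mul_pos (mul_pos ha hδ) (sub_pos.2 hc)]

/-- Rationalised form of the root `r_*`, which also covers the degenerate case. -/
lemma rStar_eq {L δ θ : ℝ} (hL : L < 1) (hδ : 0 < δ) (hc : Real.cos θ < 1) :
    rStar L δ θ =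
      (1 - L) / (δ + √(δ ^ 2 + ((1 - L) - 2 * δ * Real.cos θ) * (1 - L))) := by
  have hpos := disc_pos (sub_pos.2 hL) hδ hc
  have hD := Real.sqrt_pos.2 hpos
  have hsq := Real.sq_sqrt hpos.le
  unfold rStar
  split_ifs with h
  · rw [h, sub_self, zero_mul, add_zero, Real.sqrt_sq hδ.le, two_mul]
  · have hk : 2 * δ * Real.cos θ - 1 + L ≠ 0 := fun h' => h (by linarith)
    rw [div_eq_div_iff hk (by positivity)]
    linear_combination (-1 : ℝ) * hsq

/-- The root `s_*` of `A` is the root `r_*` with `δ` replaced by `2δ`. -/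
lemma sStar_eq_rStar (L δ θ : ℝ) : sStar L δ θ = rStar L (2 * δ) θ := by
  unfold sStar rStar
  have e1 : 2 * (2 * δ) = 4 * δ := by ring
  have e2 : (2 * δ) ^ 2 + ((1 - L) - 4 * δ * Real.cos θ) * (1 - L) =
      4 * δ ^ 2 - (4 * δ * Real.cos θ - (1 - L)) * (1 - L) := by ring
  have e3 : 4 * δ * Real.cos θ - 1 + L = 4 * δ * Real.cos θ - (1 - L) := by ring
  rw [e1, e2, e3]

/-- `1 - L - Q` is a positive multiple of `r_* - r` on `(0, 1)`. -/
lemma exists_sub_Q_eq {L δ θ r : ℝ} (hL : L < 1) (hδ : 0 < δ) (hc : Real.cos θ < 1)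
    (hr0 : 0 ≤ r) (hr1 : r < 1) :
    ∃ w > 0, (1 - L) - Q δ θ r = (rStar L δ θ - r) * w := by
  have ha : 0 < 1 - L := sub_pos.2 hL
  have hpos := disc_pos ha hδ hc
  have hD := Real.sqrt_pos.2 hpos
  have hsq := Real.sq_sqrt hpos.le
  rw [rStar_eq hL hδ hc]
  set D := √(δ ^ 2 + ((1 - L) - 2 * δ * Real.cos θ) * (1 - L))
  set a := 1 - L
  set c := Real.cos θ
  have hr2 : 0 < 1 - r ^ 2 := by nlinarith
  have hk : 2 * δ * c - a < δ + D := by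
    by_contra! hcon
    have h1 : D ≤ 2 * δ * c - a - δ := by linarith
    have h2 : D ^ 2 ≤ (2 * δ * c - a - δ) ^ 2 := by gcongr
    nlinarith [mul_pos hδ (sub_pos.2 hc), mul_pos ha hδ]
  have hw : 0 < δ + D - (2 * δ * c - a) * r := by
    rcases le_total (2 * δ * c - a) 0 with h | h
    · nlinarith
    · nlinarith
  refine ⟨(δ + D - (2 * δ * c - a) * r) / (1 - r ^ 2), by positivity, ?_⟩
  unfold Q
  have : δ + D ≠ 0 := by positivity
  field_simp
  linear_combination r * hsq

lemma rStar_pos {L δ θ : ℝ} (hL : L < 1) (hδ : 0 < δ) (hc : Real.cos θ < 1) :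
    0 < rStar L δ θ := by
  rw [rStar_eq hL hδ hc]
  have := Real.sqrt_nonneg (δ ^ 2 + ((1 - L) - 2 * δ * Real.cos θ) * (1 - L))
  have ha : 0 < 1 - L := sub_pos.2 hL
  positivity

lemma rStar_lt_one {L δ θ : ℝ} (hL : L < 1) (hδ : 0 < δ) (hc : Real.cos θ < 1) :
    rStar L δ θ < 1 := by
  have ha : 0 < 1 - L := sub_pos.2 hL
  have hpos := disc_pos ha hδ hc
  have hD := Real.sqrt_pos.2 hpos
  have hsq := Real.sq_sqrt hpos.le
  rw [rStar_eq hL hδ hc, div_lt_one (by positivity)]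
  set D := √(δ ^ 2 + ((1 - L) - 2 * δ * Real.cos θ) * (1 - L))
  by_contra! hcon
  have h2 : D ^ 2 ≤ (1 - L - δ) ^ 2 := by
    have : D ≤ 1 - L - δ := by linarith
    gcongr
  nlinarith [mul_pos (mul_pos ha hδ) (sub_pos.2 hc)]

lemma Q_lt_iff {L δ θ r : ℝ} (hL : L < 1) (hδ : 0 < δ) (hc : Real.cos θ < 1)
    (hr0 : 0 ≤ r) (hr1 : r < 1) : Q δ θ r < 1 - L ↔ r < rStar L δ θ := by
  obtain ⟨w, hw, h⟩ := exists_sub_Q_eq (L := L) hL hδ hc hr0 hr1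
  rw [← sub_pos, h, mul_pos_iff_of_pos_right hw, sub_pos]

lemma Q_eq_iff {L δ θ r : ℝ} (hL : L < 1) (hδ : 0 < δ) (hc : Real.cos θ < 1)
    (hr0 : 0 ≤ r) (hr1 : r < 1) : Q δ θ r = 1 - L ↔ r = rStar L δ θ := by
  obtain ⟨w, hw, h⟩ := exists_sub_Q_eq (L := L) hL hδ hc hr0 hr1
  rw [eq_comm, ← sub_eq_zero, h, mul_eq_zero, or_iff_left hw.ne', sub_eq_zero, eq_comm]

lemma Q_two_mul (δ θ r : ℝ) : Q (2 * δ) θ r = 2 * Q δ θ r := by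
  unfold Q; ring

lemma Q_pos {δ θ r : ℝ} (hδ : 0 < δ) (hr0 : 0 < r) (hr1 : r < 1) : 0 < Q δ θ r := by
  unfold Q
  have h1 : 0 < 1 - r ^ 2 := by nlinarith
  have h2 : 0 < 1 - r * Real.cos θ := by nlinarith [Real.cos_le_one θ]
  positivity

lemma rho_eq_mul_sub_Q {L δ θ r : ℝ} (hr0 : 0 ≤ r) (hr1 : r < 1) :
    rho L δ θ r = r * (1 - L - Q δ θ r) := by
  have h1 : 1 - r ^ 2 ≠ 0 := by nlinarith
  unfold rho Q
  field_simp

lemma rhoS_eq_mul_sub {L δ θ s r : ℝ} (hs : 0 < s) (hr : 0 ≤ r) :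
    rhoS L δ θ s r = r * (1 - L - Q δ θ s * (2 * r / (s + r))) := by
  have h1 : s + r ≠ 0 := by positivity
  unfold rhoS A B
  field_simp
  ring

lemma rhoS_self {L δ θ s : ℝ} (hs : 0 < s) (hs1 : s < 1) :
    rhoS L δ θ s s = rho L δ θ s := by
  rw [rhoS_eq_mul_sub hs hs.le, rho_eq_mul_sub_Q hs.le hs1]
  field_simp
  ring

lemma rho_pos {L δ θ r : ℝ} (hL : L < 1) (hδ : 0 < δ) (hc : Real.cos θ < 1)
    (hr0 : 0 < r) (hr : r < rStar L δ θ) : 0 < rho L δ θ r := by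
  have hr1 := hr.trans (rStar_lt_one hL hδ hc)
  rw [rho_eq_mul_sub_Q hr0.le hr1]
  exact mul_pos hr0 (sub_pos.2 ((Q_lt_iff hL hδ hc hr0.le hr1).2 hr))

lemma sStar_pos {L δ θ : ℝ} (hL : L < 1) (hδ : 0 < δ) (hc : Real.cos θ < 1) :
    0 < sStar L δ θ := by
  rw [sStar_eq_rStar]; exact rStar_pos hL (by positivity) hc

lemma sStar_lt_rStar {L δ θ : ℝ} (hL : L < 1) (hδ : 0 < δ) (hc : Real.cos θ < 1) :
    sStar L δ θ < rStar L δ θ := by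
  have h0 := sStar_pos (L := L) hL hδ hc
  have hδ2 : 0 < 2 * δ := by positivity
  have h1 : sStar L δ θ < 1 := by rw [sStar_eq_rStar]; exact rStar_lt_one hL hδ2 hc
  rw [← Q_lt_iff hL hδ hc h0.le h1]
  have h2 := (Q_eq_iff hL hδ2 hc h0.le h1).2 (sStar_eq_rStar L δ θ)
  rw [Q_two_mul] at h2
  linarith [Q_pos (θ := θ) hδ h0 h1]

lemma A_pos_iff {L δ θ s : ℝ} (hL : L < 1) (hδ : 0 < δ) (hc : Real.cos θ < 1)
    (hs0 : 0 ≤ s) (hs1 : s < 1) : 0 < A L δ θ s ↔ s < sStar L δ θ := by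
  rw [sStar_eq_rStar, ← Q_lt_iff hL (by positivity) hc hs0 hs1, Q_two_mul, A, sub_pos]

lemma A_eq_zero_iff {L δ θ s : ℝ} (hL : L < 1) (hδ : 0 < δ) (hc : Real.cos θ < 1)
    (hs0 : 0 ≤ s) (hs1 : s < 1) : A L δ θ s = 0 ↔ s = sStar L δ θ := by
  rw [sStar_eq_rStar, ← Q_eq_iff hL (by positivity) hc hs0 hs1, Q_two_mul, A, sub_eq_zero,
    eq_comm]

/-! ### Comparison of `ρ_s` with `ρ` -/

/-- The comparison of `Q(r)` with `2 r Q(s) / (s + r)` depends only on the order of `r` and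
`s`, because the difference factors through `s - r`. -/
lemma exists_Q_mul_sub_eq {δ θ s r : ℝ} (hδ : 0 < δ) (hs0 : 0 < s) (hs1 : s < 1)
    (hr0 : 0 < r) (hr1 : r < 1) :
    ∃ w > 0, Q δ θ s * (2 * r / (s + r)) - Q δ θ r = (s - r) * w := by
  have h1 : 0 < 1 - r ^ 2 := by nlinarith
  have h2 : 0 < 1 - s ^ 2 := by nlinarith
  have h3 : 0 ≤ 1 + Real.cos θ := by linarith [Real.neg_one_le_cos θ]
  have h4 : 0 ≤ 1 - Real.cos θ := by linarith [Real.cos_le_one θ]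
  have h5 : 0 < (1 - s) ^ 2 * (1 - r) := by
    have := sub_pos.2 hs1; have := sub_pos.2 hr1; positivity
  have h6 : 0 < (1 + s) ^ 2 * (1 + r) := by positivity
  have h7 : 0 < (1 + Real.cos θ) / 2 * ((1 - s) ^ 2 * (1 - r)) +
      (1 - Real.cos θ) / 2 * ((1 + s) ^ 2 * (1 + r)) := by
    rcases h3.eq_or_lt with h | h
    · have : Real.cos θ = -1 := by linarith
      rw [this]; linarith
    · have := mul_pos h h5
      have := mul_nonneg h4 h6.le
      linarith
  refine ⟨((1 + Real.cos θ) / 2 * ((1 - s) ^ 2 * (1 - r)) +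
      (1 - Real.cos θ) / 2 * ((1 + s) ^ 2 * (1 + r))) *
      (2 * δ * r / ((s + r) * (1 - s ^ 2) * (1 - r ^ 2))), by positivity, ?_⟩
  have h8 : s + r ≠ 0 := by positivity
  unfold Q
  field_simp
  ring

lemma rhoS_le_rho {L δ θ s r : ℝ} (hδ : 0 < δ) (hs1 : s < 1)
    (hr0 : 0 < r) (hrs : r ≤ s) : rhoS L δ θ s r ≤ rho L δ θ r := by
  have hs0 := hr0.trans_le hrs
  have hr1 := hrs.trans_lt hs1
  obtain ⟨w, hw, h⟩ := exists_Q_mul_sub_eq (θ := θ) hδ hs0 hs1 hr0 hr1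
  rw [rhoS_eq_mul_sub hs0 hr0.le, rho_eq_mul_sub_Q hr0.le hr1]
  have := mul_nonneg (sub_nonneg.2 hrs) hw.le
  gcongr
  linarith

lemma rhoS_pos {L δ θ s r : ℝ} (hL : L < 1) (hδ : 0 < δ) (hc : Real.cos θ < 1)
    (hs0 : 0 < s) (hs : s < rStar L δ θ) (hr0 : 0 < r) (hr : r < rStar L δ θ) :
    0 < rhoS L δ θ s r := by
  have hs1 := hs.trans (rStar_lt_one hL hδ hc)
  have hr1 := hr.trans (rStar_lt_one hL hδ hc)
  rw [rhoS_eq_mul_sub hs0 hr0.le]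
  refine mul_pos hr0 (sub_pos.2 ?_)
  rcases le_total r s with h | h
  · refine lt_of_le_of_lt ?_ ((Q_lt_iff hL hδ hc hs0.le hs1).2 hs)
    refine mul_le_of_le_one_right (Q_pos hδ hs0 hs1).le ?_
    rw [div_le_one (by positivity)]
    linarith
  · refine lt_of_le_of_lt ?_ ((Q_lt_iff hL hδ hc hr0.le hr1).2 hr)
    obtain ⟨w, hw, h'⟩ := exists_Q_mul_sub_eq (θ := θ) hδ hs0 hs1 hr0 hr1
    have := mul_nonneg (sub_nonneg.2 h) hw.le
    linarith

lemma rho_sub_rhoS {L δ θ s r : ℝ} (hs0 : 0 < s) (hs1 : s < 1) (hr0 : 0 < r) :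
    rho L δ θ s - rhoS L δ θ s r =
      (s - r) / (s + r) * ((1 - L) * (s + r) - Q δ θ s * (s + 2 * r)) := by
  rw [rhoS_eq_mul_sub hs0 hr0.le, rho_eq_mul_sub_Q hs0.le hs1]
  have : s + r ≠ 0 := by positivity
  field_simp
  ring

lemma forall_rhoS_le_iff {L δ θ s : ℝ} (hL : L < 1) (hδ : 0 < δ) (hc : Real.cos θ < 1)
    (hs0 : 0 < s) (hs : s < rStar L δ θ) :
    (∀ r ∈ Set.Ioc 0 s, rhoS L δ θ s r ≤ rho L δ θ s) ↔ Q δ θ s ≤ 2 / 3 * (1 - L) := by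
  have hs1 := hs.trans (rStar_lt_one hL hδ hc)
  have hQ := (Q_lt_iff hL hδ hc hs0.le hs1).2 hs
  have hQ0 := Q_pos (θ := θ) hδ hs0 hs1
  constructor
  · intro h
    by_contra! hcon
    -- just below `s`, namely above `t = s (1 - L - Q) / (2 Q - (1 - L))`, the bound fails
    have hk : 0 < 2 * Q δ θ s - (1 - L) := by linarith
    have ht : s * (1 - L - Q δ θ s) / (2 * Q δ θ s - (1 - L)) < s := by
      rw [div_lt_iff₀ hk]
      nlinarith
    obtain ⟨r, hr1, hr2⟩ := exists_between ht
    have hr0 : 0 < r := lt_of_le_of_lt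
      (div_nonneg (mul_nonneg hs0.le (by linarith)) hk.le) hr1
    have h1 := h r ⟨hr0, hr2.le⟩
    rw [← sub_nonneg, rho_sub_rhoS hs0 hs1 hr0] at h1
    rw [div_lt_iff₀ hk] at hr1
    refine absurd h1 (not_le.2 (mul_neg_of_pos_of_neg (div_pos (by linarith) (by linarith)) ?_))
    linarith
  · rintro h r ⟨hr0, hrs⟩
    rw [← sub_nonneg, rho_sub_rhoS hs0 hs1 hr0]
    refine mul_nonneg (div_nonneg (by linarith) (by linarith)) ?_
    nlinarith

/-! ### The extremum of `ρ` -/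

lemma rho_eq_partial_fractions {L δ θ r : ℝ} (hr0 : 0 ≤ r) (hr1 : r < 1) :
    rho L δ θ r = (1 - L) * r - 2 * δ * (-1 + Real.cos θ * r +
      (1 - Real.cos θ) / 2 * (1 - r)⁻¹ + (1 + Real.cos θ) / 2 * (1 + r)⁻¹) := by
  have h1 : 1 - r ≠ 0 := by linarith
  have h2 : 1 + r ≠ 0 := by linarith
  have h3 : 1 - r ^ 2 ≠ 0 := by
    have : 1 - r ^ 2 = (1 - r) * (1 + r) := by ring
    rw [this]; positivity
  unfold rho
  field_simp
  ring

/-- The derivative of `ρ` on `(0, 1)`, read off from the partial fractions. -/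
noncomputable def rhoDeriv (L δ θ r : ℝ) : ℝ :=
  (1 - L) - 2 * δ * (Real.cos θ + (1 - Real.cos θ) / 2 * ((1 - r) ^ 2)⁻¹ -
    (1 + Real.cos θ) / 2 * ((1 + r) ^ 2)⁻¹)

lemma hasDerivAt_rho {L δ θ r : ℝ} (hr0 : 0 < r) (hr1 : r < 1) :
    HasDerivAt (rho L δ θ) (rhoDeriv L δ θ r) r := by
  have h1 : 1 - r ≠ 0 := by linarith
  have h2 : 1 + r ≠ 0 := by linarith
  have e1 : HasDerivAt (fun x : ℝ => (1 - x)⁻¹) (((1 - r) ^ 2)⁻¹) r := by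
    have := ((hasDerivAt_id r).const_sub 1).inv h1
    exact this.congr_deriv (by simp)
  have e2 : HasDerivAt (fun x : ℝ => (1 + x)⁻¹) (-((1 + r) ^ 2)⁻¹) r := by
    have := ((hasDerivAt_id r).const_add 1).inv h2
    exact this.congr_deriv (by simp [div_eq_mul_inv])
  have h := ((hasDerivAt_id r).const_mul (1 - L)).sub
    (((((hasDerivAt_id r).const_mul (Real.cos θ)).const_add (-1)).add
      (e1.const_mul ((1 - Real.cos θ) / 2))).add
      (e2.const_mul ((1 + Real.cos θ) / 2)) |>.const_mul (2 * δ))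
  refine (h.congr_of_eventuallyEq ?_).congr_deriv ?_
  · filter_upwards [Ioo_mem_nhds hr0 hr1] with x hx
    rw [rho_eq_partial_fractions hx.1.le hx.2]
    rfl
  · unfold rhoDeriv
    ring

lemma rhoDeriv_strictAntiOn {L δ θ : ℝ} (hδ : 0 < δ) (hc : Real.cos θ < 1) :
    StrictAntiOn (rhoDeriv L δ θ) (Set.Ico 0 1) := by
  intro x hx y hy hxy
  have hx1 : 0 < 1 - x := sub_pos.2 hx.2
  have hy1 : 0 < 1 - y := sub_pos.2 hy.2
  have hx2 : 0 < 1 + x := by linarith [hx.1]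
  have h1 : ((1 - x) ^ 2)⁻¹ < ((1 - y) ^ 2)⁻¹ := by gcongr
  have h2 : ((1 + y) ^ 2)⁻¹ ≤ ((1 + x) ^ 2)⁻¹ := by gcongr
  have h3 : 0 < (1 - Real.cos θ) / 2 := by linarith
  have h4 : 0 ≤ (1 + Real.cos θ) / 2 := by linarith [Real.neg_one_le_cos θ]
  unfold rhoDeriv
  have := mul_lt_mul_of_pos_left h1 h3
  have := mul_le_mul_of_nonneg_left h2 h4
  nlinarith

/-- The tangent to the convex function `x ↦ x⁻¹` lies below its graph. -/
lemma inv_tangent_le {x y : ℝ} (hx : 0 < x) (hy : 0 < y) :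
    x⁻¹ - (y - x) * (x ^ 2)⁻¹ ≤ y⁻¹ := by
  have : y⁻¹ - (x⁻¹ - (y - x) * (x ^ 2)⁻¹) = (y - x) ^ 2 / (y * x ^ 2) := by
    field_simp; ring
  have : 0 ≤ (y - x) ^ 2 / (y * x ^ 2) := by positivity
  linarith

/-- `ρ` is concave: it lies below its tangents. -/
lemma rho_le_tangent {L δ θ x y : ℝ} (hδ : 0 < δ)
    (hx : x ∈ Set.Ioo (0 : ℝ) 1) (hy : y ∈ Set.Ioo (0 : ℝ) 1) :
    rho L δ θ y ≤ rho L δ θ x + rhoDeriv L δ θ x * (y - x) := by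
  rw [rho_eq_partial_fractions hx.1.le hx.2, rho_eq_partial_fractions hy.1.le hy.2, rhoDeriv]
  have h1 := inv_tangent_le (sub_pos.2 hx.2) (sub_pos.2 hy.2)
  have h2 := inv_tangent_le (add_pos one_pos hx.1) (add_pos one_pos hy.1)
  have h3 : 0 ≤ (1 - Real.cos θ) / 2 := by linarith [Real.cos_le_one θ]
  have h4 : 0 ≤ (1 + Real.cos θ) / 2 := by linarith [Real.neg_one_le_cos θ]
  have h5 := mul_le_mul_of_nonneg_left h1 h3
  have h6 := mul_le_mul_of_nonneg_left h2 h4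
  have h7 := mul_le_mul_of_nonneg_left (add_le_add h5 h6) (by positivity : 0 ≤ 2 * δ)
  linarith

lemma exists_rho_max {L δ θ : ℝ} (hL : L < 1) (hδ : 0 < δ) (hc : Real.cos θ < 1) :
    ∃ r₀ ∈ Set.Ioo 0 (rStar L δ θ),
      (∀ r ∈ Set.Ioo 0 (rStar L δ θ), HasDerivAt (rho L δ θ) 0 r ↔ r = r₀) ∧
      IsMaxOn (rho L δ θ) (Set.Ioo 0 1) r₀ := by
  have hp := rStar_pos (L := L) hL hδ hc
  have h1 := rStar_lt_one (L := L) hL hδ hc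
  have hcont : ContinuousOn (rho L δ θ) (Set.Icc 0 (rStar L δ θ)) := by
    unfold rho
    refine ContinuousOn.mul (continuousOn_id.div (by fun_prop) fun x hx => ?_) (by fun_prop)
    nlinarith [hx.1, hx.2]
  have hends : rho L δ θ 0 = rho L δ θ (rStar L δ θ) := by
    rw [rho_eq_mul_sub_Q le_rfl one_pos, rho_eq_mul_sub_Q hp.le h1,
      (Q_eq_iff hL hδ hc hp.le h1).2 rfl]
    ring
  have hd : ∀ x ∈ Set.Ioo 0 (rStar L δ θ), HasDerivAt (rho L δ θ) (rhoDeriv L δ θ x) x :=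
    fun x hx => hasDerivAt_rho hx.1 (hx.2.trans h1)
  obtain ⟨r₀, hr₀, h0⟩ := exists_hasDerivAt_eq_zero hp hcont hends hd
  refine ⟨r₀, hr₀, fun r hr => ⟨fun h => ?_, fun h => ?_⟩, fun y hy => ?_⟩
  · refine (rhoDeriv_strictAntiOn (L := L) hδ hc).injOn ⟨hr.1.le, hr.2.trans h1⟩
      ⟨hr₀.1.le, hr₀.2.trans h1⟩ ?_
    exact ((hd r hr).unique h).trans h0.symm
  · subst h
    exact h0 ▸ hd r hr
  · have := rho_le_tangent (L := L) (θ := θ) hδ ⟨hr₀.1, hr₀.2.trans h1⟩ hy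
    rw [h0] at this
    show rho L δ θ y ≤ rho L δ θ r₀
    linarith

/-! ### The extremum of `ρ_s` -/

lemma rhoS_strictMonoOn {L δ θ s : ℝ} (hL : L < 1) (hs0 : 0 < s) (hA : 0 ≤ A L δ θ s) :
    StrictMonoOn (rhoS L δ θ s) (Set.Ioc 0 s) := by
  rintro x ⟨hx, -⟩ y ⟨hy, -⟩ hxy
  unfold rhoS
  rw [div_lt_div_iff₀ (by positivity) (by positivity)]
  have hB : 0 < B L s := mul_pos hs0 (sub_pos.2 hL)
  have h1 : 0 < (y - x) * (A L δ θ s * (s * (x + y) + x * y) + B L s * s) :=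
    mul_pos (sub_pos.2 hxy) (by positivity)
  linarith

lemma isGreatest_rhoS_self {L δ θ s : ℝ} (hL : L < 1) (hs0 : 0 < s) (hA : 0 ≤ A L δ θ s) :
    IsGreatest (rhoS L δ θ s '' Set.Ioc 0 s) (rhoS L δ θ s s) := by
  refine ⟨⟨s, ⟨hs0, le_rfl⟩, rfl⟩, ?_⟩
  rintro _ ⟨r, hr, rfl⟩
  exact (rhoS_strictMonoOn hL hs0 hA).monotoneOn hr ⟨hs0, le_rfl⟩ hr.2

/-- In the variable `u = s + r`, up to a constant, `ρ_s` is `-(κ u + 2 Q s² / u)` with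
`κ = 2 Q - (1 - L)`, so that it is largest at `u² = 2 Q s² / κ`. -/
lemma rhoS_le_rhoS_rZero {L δ θ s r : ℝ} (hs0 : 0 < s) (hr0 : 0 < r)
    (hQ : 0 < Q δ θ s) (hA : A L δ θ s < 0) :
    rhoS L δ θ s r ≤ rhoS L δ θ s (rZero L δ θ s) := by
  have hk : 0 < 2 * Q δ θ s - (1 - L) := by unfold A at hA; linarith
  unfold rZero rhoS A B
  set q := Q δ θ s
  set k := 2 * q - (1 - L) with hk_def
  have hL : L = 1 - 2 * q + k := by rw [hk_def]; ring
  have hm0 : 0 < 2 * q / k := by positivity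
  have hm := Real.sqrt_pos.2 hm0
  have hsq := Real.sq_sqrt hm0.le
  set m := √(2 * q / k)
  have hq : q = k * m ^ 2 / 2 := by rw [hsq]; field_simp
  have e : s + (m - 1) * s = m * s := by ring
  rw [e, hL, hq, ← sub_nonneg]
  have hsr : 0 < s + r := by positivity
  have : (((1 - (1 - 2 * (k * m ^ 2 / 2) + k) - 2 * (k * m ^ 2 / 2)) * ((m - 1) * s) ^ 2 +
      s * (1 - (1 - 2 * (k * m ^ 2 / 2) + k)) * ((m - 1) * s)) / (m * s) -
      ((1 - (1 - 2 * (k * m ^ 2 / 2) + k) - 2 * (k * m ^ 2 / 2)) * r ^ 2 +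
      s * (1 - (1 - 2 * (k * m ^ 2 / 2) + k)) * r) / (s + r)) =
      k * (s + r - m * s) ^ 2 / (s + r) := by
    field_simp
    ring
  rw [this]
  positivity

lemma rZero_mem_Ioo {L δ θ s : ℝ} (hL : L < 1) (hs0 : 0 < s)
    (hQ : 2 / 3 * (1 - L) < Q δ θ s) : rZero L δ θ s ∈ Set.Ioo 0 s := by
  have ha : 0 < 1 - L := sub_pos.2 hL
  have hk : 0 < 2 * Q δ θ s - (1 - L) := by linarith
  have h1 : 1 < √(2 * Q δ θ s / (2 * Q δ θ s - (1 - L))) := by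
    rw [Real.lt_sqrt zero_le_one, lt_div_iff₀ hk]
    linarith
  have h2 : √(2 * Q δ θ s / (2 * Q δ θ s - (1 - L))) < 2 := by
    rw [Real.sqrt_lt' two_pos, div_lt_iff₀ hk]
    linarith
  unfold rZero
  constructor
  · exact mul_pos (by linarith) hs0
  · nlinarith

open Metric Set Filter Topology

/-! ### Cauchy estimates for holomorphic maps of normed spaces -/

section Cauchy

variable {E F : Type*} [NormedAddCommGroup E] [NormedSpace ℂ E] [NormedAddCommGroup F]
  [NormedSpace ℂ F]

lemma norm_fderiv_le_of_norm_le {f : E → F} {c : E} {R M : ℝ} (hR : 0 < R)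
    (hd : DifferentiableOn ℂ f (ball c R)) (hM : ∀ x ∈ ball c R, ‖f x‖ ≤ M) :
    ‖fderiv ℂ f c‖ ≤ 2 * M / R := by
  refine Complex.norm_fderiv_le_div_of_mapsTo_ball hd (fun x hx => ?_) hR
  rw [mem_closedBall, dist_eq_norm]
  linarith [norm_sub_le (f x) (f c), hM x hx, hM c (mem_ball_self hR)]

lemma norm_fderiv_le_of_mem_closedBall {f : E → F} {c x : E} {r R M : ℝ} (hrR : r < R)
    (hd : DifferentiableOn ℂ f (ball c R)) (hM : ∀ x ∈ ball c R, ‖f x‖ ≤ M)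
    (hx : x ∈ closedBall c r) : ‖fderiv ℂ f x‖ ≤ 2 * M / (R - r) := by
  have hsub : ball x (R - r) ⊆ ball c R := ball_subset_ball' (by
    rw [mem_closedBall] at hx; linarith)
  exact norm_fderiv_le_of_norm_le (sub_pos.2 hrR) (hd.mono hsub) fun y hy => hM y (hsub hy)

lemma norm_sub_le_of_mem_closedBall {f : E → F} {c x y : E} {r R M : ℝ} (hrR : r < R)
    (hd : DifferentiableOn ℂ f (ball c R)) (hM : ∀ x ∈ ball c R, ‖f x‖ ≤ M)
    (hx : x ∈ closedBall c r) (hy : y ∈ closedBall c r) :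
    ‖f y - f x‖ ≤ 2 * M / (R - r) * ‖y - x‖ :=
  Convex.norm_image_sub_le_of_norm_fderiv_le (𝕜 := ℂ)
    (fun _ hz => hd.differentiableAt (isOpen_ball.mem_nhds (closedBall_subset_ball hrR hz)))
    (fun _ hz => norm_fderiv_le_of_mem_closedBall hrR hd hM hz) (convex_closedBall c r) hx hy

/-- The derivative of a holomorphic map is continuous: apply the Cauchy estimate to the
differences `u ↦ f (u + (y - x)) - f u`, which are `O(‖y - x‖)`. -/
lemma continuousAt_fderiv {f : E → F} {x : E}
    (hd : ∀ᶠ y in 𝓝 x, DifferentiableAt ℂ f y) : ContinuousAt (fderiv ℂ f) x := by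
  have hc : ContinuousAt f x := hd.self_of_nhds.continuousAt
  have hb : ∀ᶠ y in 𝓝 x, ‖f y‖ ≤ ‖f x‖ + 1 := by
    filter_upwards [hc.norm.eventually_lt continuousAt_const (lt_add_one ‖f x‖)] with y hy
      using hy.le
  obtain ⟨R, hR, hball⟩ := Metric.eventually_nhds_iff_ball.1 (hd.and hb)
  set M := ‖f x‖ + 1
  have hdiff : DifferentiableOn ℂ f (ball x R) :=
    fun y hy => (hball y hy).1.differentiableWithinAt
  have hR2 : R / 2 < R := half_lt_self hR
  rw [Metric.continuousAt_iff']
  intro ε hε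
  set K := 2 * M / (R - R / 2)
  have hev : ∀ᶠ y in 𝓝 x, 2 * (K * ‖y - x‖) / (R / 4) < ε := by
    have : ContinuousAt (fun y => 2 * (K * ‖y - x‖) / (R / 4)) x := by fun_prop
    exact this.eventually_lt continuousAt_const (by simpa using hε)
  filter_upwards [hev, ball_mem_nhds x (show 0 < R / 4 by positivity)] with y hy hyx
  refine lt_of_le_of_lt ?_ hy
  rw [mem_ball, dist_eq_norm] at hyx
  have hmem : ∀ u ∈ ball x (R / 4), u ∈ closedBall x (R / 2) ∧
      u + (y - x) ∈ closedBall x (R / 2) := by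
    intro u hu
    rw [mem_ball, dist_eq_norm] at hu
    rw [mem_closedBall, mem_closedBall, dist_eq_norm, dist_eq_norm]
    refine ⟨by linarith, ?_⟩
    have : u + (y - x) - x = (u - x) + (y - x) := by abel
    rw [this]
    linarith [norm_add_le (u - x) (y - x)]
  have hat : ∀ u ∈ closedBall x (R / 2), DifferentiableAt ℂ f u := fun u hu =>
    (hball u (closedBall_subset_ball hR2 hu)).1
  have hder : ∀ u ∈ ball x (R / 4), HasFDerivAt (fun u => f (u + (y - x)) - f u)
      (fderiv ℂ f (u + (y - x)) - fderiv ℂ f u) u := by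
    intro u hu
    exact ((hasFDerivAt_comp_add_right (y - x)).2 (hat _ (hmem u hu).2).hasFDerivAt).sub
      (hat _ (hmem u hu).1).hasFDerivAt
  have key := norm_fderiv_le_of_norm_le (M := K * ‖y - x‖) (show 0 < R / 4 by positivity)
    (fun u hu => (hder u hu).differentiableAt.differentiableWithinAt) (fun u hu => by
      have := norm_sub_le_of_mem_closedBall hR2 hdiff (fun z hz => (hball z hz).2)
        (hmem u hu).1 (hmem u hu).2
      rwa [add_sub_cancel_left] at this)
  rw [(hder x (mem_ball_self (by positivity))).fderiv, add_sub_cancel] at key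
  rwa [dist_eq_norm]

lemma hasStrictFDerivAt_of_eventually_differentiableAt {f : E → F} {x : E}
    (hd : ∀ᶠ y in 𝓝 x, DifferentiableAt ℂ f y) :
    HasStrictFDerivAt f (fderiv ℂ f x) x :=
  hasStrictFDerivAt_of_hasFDerivAt_of_continuousAt
    (hd.mono fun _ hy => hy.hasFDerivAt) (continuousAt_fderiv hd)

end Cauchy

/-! ### The Earle–Hamilton fixed point theorem for balls -/

section EarleHamilton

variable {E : Type*} [NormedAddCommGroup E] [NormedSpace ℂ E]

/-- If `f` maps `ball 0 R` into `closedBall 0 r` with `r < R`, then for every `p` the map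
`y ↦ f y + ε (f y - f p)` still maps the ball into itself for a fixed `ε > 0`, and has derivative
`(1 + ε) f'(p)` at `p`. Composing such maps along the orbit of `x` inflates the derivative of
the iterate `f^[n]` at `x` by `(1 + ε) ^ n` within the self-maps of the ball. -/
lemma exists_inflated_iterate {f : E → E} {r R ε : ℝ} (hε : 0 < ε)
    (hεR : r + 2 * r * ε < R) (hd : DifferentiableOn ℂ f (ball 0 R))
    (hf : MapsTo f (ball 0 R) (closedBall 0 r)) (hr : r < R) {x : E} (hx : x ∈ ball 0 R)
    (n : ℕ) :
    f^[n] x ∈ ball 0 R ∧ DifferentiableAt ℂ f^[n] x ∧ ∃ g : E → E,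
      DifferentiableOn ℂ g (ball 0 R) ∧ MapsTo g (ball 0 R) (ball 0 R) ∧ g x = f^[n] x ∧
      fderiv ℂ g x = ((1 + ε : ℝ) : ℂ) ^ n • fderiv ℂ f^[n] x := by
  induction n with
  | zero =>
    refine ⟨hx, differentiableAt_id, id, differentiableOn_id, mapsTo_id _, rfl, ?_⟩
    rw [pow_zero, one_smul]; rfl
  | succ n ih =>
    obtain ⟨hmem, hdn, g, hgd, hgm, hgx, hgf⟩ := ih
    have hfat : DifferentiableAt ℂ f (f^[n] x) :=
      hd.differentiableAt (isOpen_ball.mem_nhds hmem)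
    have hgat : DifferentiableAt ℂ g x := hgd.differentiableAt (isOpen_ball.mem_nhds hx)
    have hcomp : HasFDerivAt f^[n + 1]
        ((fderiv ℂ f (f^[n] x)).comp (fderiv ℂ f^[n] x)) x := by
      rw [Function.iterate_succ']
      exact hfat.hasFDerivAt.comp x hdn.hasFDerivAt
    have hFat : HasFDerivAt (fun y => f y + (ε : ℂ) • (f y - f (f^[n] x)))
        (fderiv ℂ f (f^[n] x) + (ε : ℂ) • fderiv ℂ f (f^[n] x)) (g x) := by
      rw [hgx]
      exact hfat.hasFDerivAt.add ((hfat.hasFDerivAt.sub_const _).const_smul _)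
    refine ⟨?_, hcomp.differentiableAt,
      (fun y => f y + (ε : ℂ) • (f y - f (f^[n] x))) ∘ g, ?_, ?_, ?_, ?_⟩
    · rw [Function.iterate_succ_apply']
      exact closedBall_subset_ball hr (hf hmem)
    · exact (hd.add ((hd.sub_const _).const_smul _)).comp hgd hgm
    · intro y hy
      have h1 := mem_closedBall_zero_iff.1 (hf (hgm hy))
      have h2 := mem_closedBall_zero_iff.1 (hf hmem)
      rw [mem_ball_zero_iff]
      calc ‖f (g y) + (ε : ℂ) • (f (g y) - f (f^[n] x))‖
          ≤ ‖f (g y)‖ + ‖(ε : ℂ) • (f (g y) - f (f^[n] x))‖ := norm_add_le _ _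
        _ ≤ r + ε * (2 * r) := by
          rw [norm_smul, Complex.norm_real, Real.norm_of_nonneg hε.le]
          gcongr
          linarith [norm_sub_le (f (g y)) (f (f^[n] x))]
        _ < R := by linarith
    · simp only [Function.comp_apply, hgx, sub_self, smul_zero, add_zero,
        Function.iterate_succ_apply']
    · rw [(hFat.comp x hgat.hasFDerivAt).fderiv, hcomp.fderiv, hgf]
      ext v
      simp only [ContinuousLinearMap.comp_apply, add_apply,
        smul_apply, map_smul, pow_succ, Complex.ofReal_add,
        Complex.ofReal_one]
      module

/-- Geometric decay of the derivatives of the iterates, uniform on smaller balls: some iterate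
has derivative of norm at most `1 / 2` throughout `closedBall 0 r`. -/
lemma exists_norm_fderiv_iterate_le {f : E → E} {r R : ℝ} (hr0 : 0 ≤ r) (hr : r < R)
    (hd : DifferentiableOn ℂ f (ball 0 R)) (hf : MapsTo f (ball 0 R) (closedBall 0 r)) :
    ∃ n : ℕ, ∀ x ∈ closedBall (0 : E) r, DifferentiableAt ℂ f^[n] x ∧
      ‖fderiv ℂ f^[n] x‖ ≤ 1 / 2 := by
  have hR : 0 < R := hr0.trans_lt hr
  set ε := (R - r) / (2 * R)
  have hε : 0 < ε := div_pos (sub_pos.2 hr) (by positivity)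
  have hεR : r + 2 * r * ε < R := by
    have : 2 * r * ε = r * (R - r) / R := by
      simp only [ε]; field_simp
    rw [this, ← lt_sub_iff_add_lt', div_lt_iff₀ hR]
    nlinarith
  obtain ⟨n, hn⟩ := pow_unbounded_of_one_lt (2 * (2 * R / (R - r))) (lt_add_of_pos_right 1 hε)
  refine ⟨n, fun x hx => ?_⟩
  obtain ⟨-, hdn, g, hgd, hgm, -, hgf⟩ :=
    exists_inflated_iterate hε hεR hd hf hr (closedBall_subset_ball hr hx) n
  refine ⟨hdn, ?_⟩
  have h1 := norm_fderiv_le_of_mem_closedBall hr hgd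
    (fun y hy => (mem_ball_zero_iff.1 (hgm hy)).le) hx
  rw [hgf, norm_smul, norm_pow, Complex.norm_real, Real.norm_of_nonneg (by positivity)] at h1
  have h2 : (1 + ε) ^ n * ‖fderiv ℂ f^[n] x‖ ≤ (1 + ε) ^ n * (1 / 2) := by linarith
  exact le_of_mul_le_mul_left h2 (by positivity)

lemma isUnit_one_sub_of_norm_pow_lt_one {A : Type*} [NormedRing A] [HasSummableGeomSeries A]
    {a : A} {n : ℕ} (h : ‖a ^ n‖ < 1) : IsUnit (1 - a) := by
  have h1 := isUnit_one_sub_of_norm_lt_one h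
  rw [← mul_neg_geom_sum] at h1
  have hcomm : Commute (1 - a) (∑ i ∈ Finset.range n, a ^ i) := by
    rw [commute_iff_eq, mul_neg_geom_sum, geom_sum_mul_neg]
  exact (hcomm.isUnit_mul_iff.1 h1).1

/-- **Earle–Hamilton theorem** for balls. A holomorphic map of a ball strictly inside itself has
a unique fixed point, at which moreover `1 - f'` is invertible. -/
theorem exists_fixedPoint_of_mapsTo_closedBall [CompleteSpace E] {f : E → E} {r R : ℝ}
    (hr0 : 0 ≤ r) (hr : r < R) (hd : DifferentiableOn ℂ f (ball 0 R))
    (hf : MapsTo f (ball 0 R) (closedBall 0 r)) :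
    ∃ x ∈ ball (0 : E) R, f x = x ∧ IsUnit (1 - fderiv ℂ f x) ∧
      ∀ y ∈ ball (0 : E) R, f y = y → y = x := by
  obtain ⟨n, hn⟩ := exists_norm_fderiv_iterate_le hr0 hr hd hf
  have hlip : ∀ x ∈ closedBall (0 : E) r, ∀ y ∈ closedBall (0 : E) r,
      ‖f^[n] y - f^[n] x‖ ≤ 1 / 2 * ‖y - x‖ := fun x hx y hy =>
    Convex.norm_image_sub_le_of_norm_fderiv_le (𝕜 := ℂ) (fun z hz => (hn z hz).1)
      (fun z hz => (hn z hz).2) (convex_closedBall 0 r) hx hy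
  have hmaps : MapsTo f (closedBall 0 r) (closedBall 0 r) :=
    hf.mono_left (closedBall_subset_ball hr)
  have hcontr : ContractingWith (1 / 2 : NNReal) (hmaps.restrict f _ _)^[n] := by
    rw [hmaps.iterate_restrict]
    refine ⟨by rw [← NNReal.coe_lt_coe]; norm_num, LipschitzWith.of_dist_le_mul fun x y => ?_⟩
    rw [Subtype.dist_eq, Subtype.dist_eq, dist_eq_norm, dist_eq_norm]
    simpa using hlip y y.2 x x.2
  have : Nonempty (closedBall (0 : E) r) := ⟨⟨0, mem_closedBall_self hr0⟩⟩
  have : CompleteSpace (closedBall (0 : E) r) := isClosed_closedBall.completeSpace_coe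
  have hfix := hcontr.isFixedPt_fixedPoint_iterate
  set x := hcontr.fixedPoint (hmaps.restrict f _ _)^[n]
  have hxf : f x = x := congrArg Subtype.val hfix
  have hxR : (x : E) ∈ ball 0 R := closedBall_subset_ball hr x.2
  refine ⟨x, hxR, hxf, ?_, fun y hy hyf => ?_⟩
  · refine isUnit_one_sub_of_norm_pow_lt_one (n := n) ?_
    have h1 := ((hd.differentiableAt (isOpen_ball.mem_nhds hxR)).hasFDerivAt.iterate hxf n).fderiv
    rw [← h1]
    linarith [(hn x x.2).2]
  · have hyr : y ∈ closedBall (0 : E) r := hyf ▸ hf hy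
    have h1 := hlip x x.2 y hyr
    rw [(show Function.IsFixedPt f (x : E) from hxf).iterate n,
      (show Function.IsFixedPt f y from hyf).iterate n] at h1
    rw [← sub_eq_zero, ← norm_eq_zero]
    linarith [norm_nonneg (y - x)]

end EarleHamilton

section HolomorphicMaps

variable {E : Type*} [NormedAddCommGroup E] [NormedSpace ℂ E]

/-! ### Zeros of holomorphic maps that point outwards near a sphere -/

lemma norm_eq_of_mem_J {x : E} {φ : StrongDual ℂ E} (hφ : φ ∈ J x) : ‖φ‖ = ‖x‖ :=
  (sq_eq_sq₀ (norm_nonneg _) (norm_nonneg _)).1 hφ.2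

lemma re_apply_self_of_mem_J {x : E} {φ : StrongDual ℂ E} (hφ : φ ∈ J x) :
    (φ x).re = ‖x‖ ^ 2 := by
  rw [hφ.1, Complex.ofReal_re]

lemma norm_apply_le_of_mem_J {x : E} {φ : StrongDual ℂ E} (hφ : φ ∈ J x) (y : E) :
    ‖φ y‖ ≤ ‖x‖ * ‖y‖ :=
  norm_eq_of_mem_J hφ ▸ φ.le_opNorm y

lemma re_apply_le_of_mem_J {x : E} {φ : StrongDual ℂ E} (hφ : φ ∈ J x) (y : E) :
    (φ y).re ≤ ‖x‖ * ‖y‖ :=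
  (Complex.re_le_norm _).trans (norm_apply_le_of_mem_J hφ y)

lemma J_nonempty (x : E) : (J x).Nonempty := by
  rcases eq_or_ne x 0 with rfl | hx
  · exact ⟨0, by simp [J]⟩
  · obtain ⟨φ, hφ, hφx⟩ := exists_dual_vector ℂ x (norm_ne_zero_iff.2 hx)
    refine ⟨(‖x‖ : ℂ) • φ, ?_, ?_⟩
    · rw [smul_apply, hφx, smul_eq_mul]
      push_cast
      exact (sq _).symm
    · rw [norm_smul, hφ, mul_one, Complex.norm_real, norm_norm]

/-- If `‖y‖` is only slightly larger than `r` and `G` points outwards where `r ≤ ‖x‖`, the solution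
`x` of `x + t G(x) = y` satisfies `‖x‖ < r`. -/
lemma norm_lt_of_add_smul_eq {x y w : E} {r R t ε : ℝ} (hr : 0 < r) (ht : 0 < t) (hε : 0 < ε)
    (hxR : ‖x‖ < R) (hy : ‖y‖ < r + t * ε / R) (hxy : x + (t : ℂ) • w = y)
    (hpos : r ≤ ‖x‖ → ∃ φ ∈ J x, ε ≤ (φ w).re) : ‖x‖ < r := by
  by_contra! hcon
  obtain ⟨φ, hφ, hφw⟩ := hpos hcon
  have hx0 : 0 < ‖x‖ := hr.trans_le hcon
  have h1 := re_apply_le_of_mem_J hφ y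
  rw [← hxy, map_add, map_smul, Complex.add_re, re_apply_self_of_mem_J hφ, smul_eq_mul,
    Complex.re_ofReal_mul, hxy] at h1
  have h2 : ‖x‖ * ‖y‖ < ‖x‖ * (r + t * ε / R) := by gcongr
  have h3 : ‖x‖ * (t * ε / R) ≤ t * ε := by
    rw [mul_div_assoc', div_le_iff₀ (hx0.trans hxR), mul_comm]
    gcongr
  nlinarith

/-- A bounded holomorphic map that points outwards in a spherical shell `r ≤ ‖x‖ < R` has exactly
one zero in the ball of radius `r`, and its derivative there is invertible. The zeros of `G` are
the fixed points of the resolvent `(1 + t G)⁻¹`, which for small `t` maps a ball of radius larger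
than `r` into the ball of radius `r`, so that the Earle–Hamilton theorem applies. -/
theorem exists_unique_zero [CompleteSpace E] {G : E → E} {r R M ε : ℝ} (hr : 0 < r) (hrR : r < R)
    (hε : 0 < ε) (hd : DifferentiableOn ℂ G (ball 0 R)) (hM : ∀ x ∈ ball (0 : E) R, ‖G x‖ ≤ M)
    (hpos : ∀ x, r ≤ ‖x‖ → ‖x‖ < R → ∃ φ ∈ J x, ε ≤ (φ (G x)).re) :
    ∃ x ∈ ball (0 : E) r, G x = 0 ∧ IsUnit (fderiv ℂ G x) ∧
      ∀ y ∈ ball (0 : E) r, G y = 0 → y = x := by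
  have hR : 0 < R := hr.trans hrR
  have hM0 : 0 ≤ M := (norm_nonneg _).trans (hM 0 (mem_ball_self hR))
  obtain ⟨R₁, hrR₁, hR₁R⟩ := exists_between hrR
  set K := 2 * M / (R - R₁)
  have hRR₁ : 0 < R - R₁ := sub_pos.2 hR₁R
  have hK : 0 ≤ K := by positivity
  have hsmall : ∀ᶠ t : ℝ in 𝓝[>] 0, t * K < 1 / 2 ∧ r + t * ε / R + t * M < R₁ := by
    have h1 : ContinuousAt (fun t : ℝ => t * K) 0 := by fun_prop
    have h2 : ContinuousAt (fun t : ℝ => r + t * ε / R + t * M) 0 := by fun_prop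
    exact ((h1.eventually_lt continuousAt_const (by norm_num)).and
      (h2.eventually_lt continuousAt_const (by simpa using hrR₁))).filter_mono nhdsWithin_le_nhds
  obtain ⟨t, ⟨htK, htR⟩, ht : 0 < t⟩ := (hsmall.and self_mem_nhdsWithin).exists
  have hnt : ‖(t : ℂ)‖ = t := by rw [Complex.norm_real, Real.norm_of_nonneg ht.le]
  set R₂ := r + t * ε / R
  have hrR₂ : r < R₂ := lt_add_of_pos_right _ (by positivity)
  have hlip : ∀ x ∈ closedBall (0 : E) R₁, ∀ y ∈ closedBall (0 : E) R₁,
      ‖(t : ℂ) • G y - (t : ℂ) • G x‖ ≤ 1 / 2 * ‖y - x‖ := by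
    intro x hx y hy
    rw [← smul_sub, norm_smul, hnt]
    calc t * ‖G y - G x‖ ≤ t * (K * ‖y - x‖) := by
          gcongr; exact norm_sub_le_of_mem_closedBall hR₁R hd hM hx hy
      _ = t * K * ‖y - x‖ := by ring
      _ ≤ 1 / 2 * ‖y - x‖ := by gcongr
  have hsubR : closedBall (0 : E) R₁ ⊆ ball 0 R := closedBall_subset_ball hR₁R
  have hsubr : ball (0 : E) r ⊆ closedBall 0 R₁ := (ball_subset_ball hrR₁.le).trans
    ball_subset_closedBall
  -- `1 + t G` is injective with Lipschitz inverse
  have hinv : ∀ x ∈ closedBall (0 : E) R₁, ∀ y ∈ closedBall (0 : E) R₁,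
      ‖y - x‖ ≤ 2 * ‖(y + (t : ℂ) • G y) - (x + (t : ℂ) • G x)‖ := by
    intro x hx y hy
    have h1 := hlip x hx y hy
    have h2 : y - x = ((y + (t : ℂ) • G y) - (x + (t : ℂ) • G x)) -
      ((t : ℂ) • G y - (t : ℂ) • G x) := by abel
    have h3 := norm_sub_le ((y + (t : ℂ) • G y) - (x + (t : ℂ) • G x))
      ((t : ℂ) • G y - (t : ℂ) • G x)
    rw [← h2] at h3
    linarith
  have hres : ∀ y, ∃ x, y ∈ ball (0 : E) R₂ → x ∈ ball (0 : E) r ∧ x + (t : ℂ) • G x = y := by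
    intro y
    by_cases hy : y ∈ ball (0 : E) R₂
    swap
    · exact ⟨0, fun h => absurd h hy⟩
    have hy' := mem_ball_zero_iff.1 hy
    have hmaps : MapsTo (fun x => y - (t : ℂ) • G x) (closedBall 0 R₁) (closedBall 0 R₁) := by
      intro x hx
      rw [mem_closedBall_zero_iff]
      calc ‖y - (t : ℂ) • G x‖ ≤ ‖y‖ + t * ‖G x‖ := by
            have := norm_sub_le y ((t : ℂ) • G x)
            rwa [norm_smul, hnt] at this
        _ ≤ R₂ + t * M := by gcongr; exact hM x (hsubR hx)
        _ ≤ R₁ := htR.le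
    have hcontr : ContractingWith (1 / 2 : NNReal) (hmaps.restrict _ _ _) := by
      refine ⟨by rw [← NNReal.coe_lt_coe]; norm_num, LipschitzWith.of_dist_le_mul fun u v => ?_⟩
      rw [Subtype.dist_eq, Subtype.dist_eq, dist_eq_norm, dist_eq_norm]
      have := hlip u u.2 v v.2
      simp only [MapsTo.val_restrict_apply, sub_sub_sub_cancel_left]
      rw [norm_sub_rev (u : E)]
      simpa using this
    obtain ⟨x, hx, hfix, -⟩ := hcontr.exists_fixedPoint' isClosed_closedBall.isComplete hmaps
      (mem_closedBall_self (hr.trans hrR₁).le) (edist_ne_top _ _)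
    have hxy : x + (t : ℂ) • G x = y := by
      have : y - (t : ℂ) • G x = x := hfix
      exact (sub_eq_iff_eq_add.1 this).symm
    have hxR : ‖x‖ < R := mem_ball_zero_iff.1 (hsubR hx)
    exact ⟨x, fun _ => ⟨mem_ball_zero_iff.2 (norm_lt_of_add_smul_eq hr ht hε hxR hy' hxy
      fun h => hpos x h hxR), hxy⟩⟩
  choose j hj using hres
  have hjr : ∀ y ∈ ball (0 : E) R₂, j y ∈ ball (0 : E) r := fun y hy => (hj y hy).1
  have hjs : ∀ y ∈ ball (0 : E) R₂, j y + (t : ℂ) • G (j y) = y := fun y hy => (hj y hy).2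
  have hder : ∀ y ∈ ball (0 : E) R₂, ∃ e : E ≃L[ℂ] E,
      (e : E →L[ℂ] E) = 1 + (t : ℂ) • fderiv ℂ G (j y) ∧
      HasFDerivAt j (e.symm : E →L[ℂ] E) y := by
    intro y hy
    have hjy := hsubr (hjr y hy)
    have hnorm : ‖-((t : ℂ) • fderiv ℂ G (j y))‖ < 1 := by
      rw [norm_neg, norm_smul, hnt]
      have h1 : t * ‖fderiv ℂ G (j y)‖ ≤ t * K := by
        gcongr; exact norm_fderiv_le_of_mem_closedBall hR₁R hd hM hjy
      linarith
    obtain ⟨u, hu⟩ := isUnit_one_sub_of_norm_lt_one hnorm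
    rw [sub_neg_eq_add] at hu
    refine ⟨ContinuousLinearEquiv.unitsEquiv ℂ E u, hu, ?_⟩
    refine HasFDerivAt.of_local_left_inverse (f := fun x => x + (t : ℂ) • G x) ?_ ?_ ?_
    · have : LipschitzOnWith 2 j (ball 0 R₂) := LipschitzOnWith.of_dist_le_mul fun u hu v hv => by
        have := hinv _ (hsubr (hjr v hv)) _ (hsubr (hjr u hu))
        rw [hjs u hu, hjs v hv] at this
        simpa [dist_eq_norm] using this
      exact this.continuousOn.continuousAt (isOpen_ball.mem_nhds hy)
    · have hGat : DifferentiableAt ℂ G (j y) :=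
        hd.differentiableAt (isOpen_ball.mem_nhds (hsubR hjy))
      have := (hasFDerivAt_id (𝕜 := ℂ) (j y)).add (hGat.hasFDerivAt.const_smul (t : ℂ))
      exact this.congr_fderiv hu.symm
    · filter_upwards [isOpen_ball.mem_nhds hy] with z hz using hjs z hz
  obtain ⟨x, hxR₂, hxj, hunit, huniq⟩ := exists_fixedPoint_of_mapsTo_closedBall (f := j) hr.le hrR₂
    (fun y hy => by
      obtain ⟨e, -, he⟩ := hder y hy
      exact he.differentiableAt.differentiableWithinAt)
    (fun y hy => ball_subset_closedBall (hjr y hy))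
  have htC : (t : ℂ) ≠ 0 := by exact_mod_cast ht.ne'
  refine ⟨x, hxj ▸ hjr x hxR₂, ?_, ?_, fun y hy hGy => ?_⟩
  · have := hjs x hxR₂
    rw [hxj, add_eq_left, smul_eq_zero] at this
    exact this.resolve_left htC
  · obtain ⟨e, he, hje⟩ := hder x hxR₂
    rw [hje.fderiv] at hunit
    rw [hxj] at he
    -- `t G'(x) = e - 1 = e (1 - e⁻¹)`
    have h1 : (t : ℂ) • fderiv ℂ G x = (e : E →L[ℂ] E) * (1 - (e.symm : E →L[ℂ] E)) := by
      have : (e : E →L[ℂ] E) * (e.symm : E →L[ℂ] E) = 1 := by ext v; simp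
      rw [mul_sub, mul_one, this, he, add_sub_cancel_left]
    have h2 : IsUnit (e : E →L[ℂ] E) := ((ContinuousLinearEquiv.unitsEquiv ℂ E).symm e).isUnit
    have h3 := h1 ▸ h2.mul hunit
    exact (isUnit_smul_iff (Units.mk0 (t : ℂ) htC) _).1 h3
  · have hyR₂ := ball_subset_ball hrR₂.le hy
    refine huniq y hyR₂ ?_
    have h1 := hinv y (hsubr hy) (j y) (hsubr (hjr y hyR₂))
    rw [hjs y hyR₂, hGy, smul_zero, add_zero, sub_self, norm_zero, mul_zero] at h1
    exact sub_eq_zero.1 (norm_le_zero_iff.1 h1)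

/-- Bloch radii from a lower bound for `Re ⟨F(x), x*⟩` on spheres of radius at least `r`. The
holomorphy of the inverse comes from the inverse function theorem. -/
theorem areBlochRadii_of_le_re [CompleteSpace E] {F : E → E} {r R M ρ : ℝ} (hr : 0 < r)
    (hr1 : r ≤ 1) (hrR : r < R) (hρ : 0 < ρ)
    (hd : DifferentiableOn ℂ F (ball 0 R)) (hM : ∀ x ∈ ball (0 : E) R, ‖F x‖ ≤ M)
    (hpos : ∀ ρ' < ρ, ∃ R' > r, ∀ x, r ≤ ‖x‖ → ‖x‖ < R' → ∃ φ ∈ J x, ρ' * ‖x‖ ≤ (φ (F x)).re) :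
    AreBlochRadii F r ρ := by
  have hsol : ∀ z, ∃ x, z ∈ ball (0 : E) ρ → x ∈ ball (0 : E) r ∧ F x = z ∧
      IsUnit (fderiv ℂ F x) ∧ ∀ y ∈ ball (0 : E) r, F y = z → y = x := by
    intro z
    by_cases hz : z ∈ ball (0 : E) ρ
    swap
    · exact ⟨0, fun h => absurd h hz⟩
    obtain ⟨ρ', hzρ', hρ'⟩ := exists_between (mem_ball_zero_iff.1 hz)
    obtain ⟨R', hR', hpos'⟩ := hpos ρ' hρ'
    have hsub : ball (0 : E) (min R R') ⊆ ball 0 R := ball_subset_ball (min_le_left _ _)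
    obtain ⟨x, hx, hGx, hu, huniq⟩ := exists_unique_zero (G := fun x => F x - z) (M := M + ‖z‖)
      (R := min R R') (ε := (ρ' - ‖z‖) * r) hr (lt_min hrR hR')
      (mul_pos (sub_pos.2 hzρ') hr) ((hd.mono hsub).sub_const z)
      (fun x hx => (norm_sub_le _ _).trans (by gcongr; exact hM x (hsub hx)))
      (fun x hx hxR => by
        obtain ⟨φ, hφ, h⟩ := hpos' x hx (hxR.trans_le (min_le_right _ _))
        refine ⟨φ, hφ, ?_⟩
        rw [map_sub, Complex.sub_re]
        have h1 := re_apply_le_of_mem_J hφ z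
        have h2 : (ρ' - ‖z‖) * r ≤ (ρ' - ‖z‖) * ‖x‖ := by
          have := sub_pos.2 hzρ'
          gcongr
        nlinarith)
    refine ⟨x, fun _ => ⟨hx, sub_eq_zero.1 hGx, ?_, fun y hy hFy =>
      huniq y hy (sub_eq_zero.2 hFy)⟩⟩
    rwa [fderiv_sub_const] at hu
  choose g hg using hsol
  refine ⟨hr, hr1, hρ, g, fun z hz => ?_, fun z hz => ⟨(hg z hz).1, (hg z hz).2.1,
    (hg z hz).2.2.2⟩⟩
  obtain ⟨hgz, hFg, ⟨u, hu⟩, -⟩ := hg z hz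
  have hdiff : ∀ᶠ y in 𝓝 (g z), DifferentiableAt ℂ F y := by
    filter_upwards [isOpen_ball.mem_nhds (ball_subset_ball hrR.le hgz)] with y hy using
      hd.differentiableAt (isOpen_ball.mem_nhds hy)
  have hstrict : HasStrictFDerivAt F
      ((ContinuousLinearEquiv.unitsEquiv ℂ E u : E ≃L[ℂ] E) : E →L[ℂ] E) (g z) := by
    have := hasStrictFDerivAt_of_eventually_differentiableAt hdiff
    rwa [← hu] at this
  have hinvd := hstrict.to_localInverse.hasFDerivAt
  rw [hFg] at hinvd
  have hev : g =ᶠ[𝓝 z] hstrict.localInverse F _ (g z) := by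
    have h1 := hstrict.eventually_right_inverse
    have h2 := hstrict.localInverse_tendsto
    rw [hFg] at h1 h2
    filter_upwards [h1, h2 (isOpen_ball.mem_nhds hgz), isOpen_ball.mem_nhds hz] with w hw1 hw2 hw3
    exact ((hg w hw3).2.2.2 _ hw2 hw1).symm
  exact (hinvd.congr_of_eventuallyEq hev).differentiableAt.differentiableWithinAt

lemma AreBlochRadii.mono {F : E → E} {r ρ ρ' : ℝ} (h : AreBlochRadii F r ρ) (h0 : 0 < ρ')
    (hle : ρ' ≤ ρ) : AreBlochRadii F r ρ' := by
  obtain ⟨h1, h2, -, g, hg, hg'⟩ := h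
  exact ⟨h1, h2, h0, g, hg.mono (ball_subset_ball hle), fun z hz =>
    hg' z (ball_subset_ball hle hz)⟩

lemma conj_smul_mem_J {x : E} {φ : StrongDual ℂ E} (hφ : φ ∈ J x) (c : ℂ) :
    (starRingEnd ℂ) c • φ ∈ J (c • x) := by
  refine ⟨?_, ?_⟩
  · rw [smul_apply, map_smul, hφ.1, norm_smul, smul_eq_mul, smul_eq_mul, ← mul_assoc,
      ← Complex.normSq_eq_conj_mul_self, Complex.normSq_eq_norm_sq, mul_pow]
    push_cast
    ring
  · rw [norm_smul, norm_smul, RCLike.norm_conj, mul_pow, mul_pow, hφ.2]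

/-! ### Homogeneous parts of a holomorphic map -/

/-- The homogeneous part of degree `n` of the Taylor expansion of `h` at the origin: the `n`-th
Taylor coefficient at `0` of the function `ζ ↦ h (ζ x)` of one variable. -/
noncomputable def homogeneousPart (h : E → E) (n : ℕ) (x : E) : E :=
  (n.factorial : ℂ)⁻¹ • iteratedDeriv n (fun ζ : ℂ => h (ζ • x)) 0

lemma iteratedDeriv_comp_mul_left (f : ℂ → E) (c : ℂ) (n : ℕ) :
    iteratedDeriv n (fun z => f (c * z)) = fun z => c ^ n • iteratedDeriv n f (c * z) := by
  induction n with
  | zero => simp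
  | succ n ih =>
    funext z
    rw [iteratedDeriv_succ, ih, iteratedDeriv_succ, deriv_fun_const_smul_field,
      deriv_comp_mul_left c (iteratedDeriv n f), smul_smul, pow_succ]

lemma homogeneousPart_smul (h : E → E) (n : ℕ) (c : ℂ) (x : E) :
    homogeneousPart h n (c • x) = c ^ n • homogeneousPart h n x := by
  have := congrFun (iteratedDeriv_comp_mul_left (fun ζ : ℂ => h (ζ • x)) c n) 0
  simp only [mul_zero] at this
  unfold homogeneousPart
  rw [smul_comm, ← this]
  simp only [smul_smul, mul_comm c]

lemma homogeneousPart_eq_circleIntegral [CompleteSpace E] {h : E → E} {r : ℝ}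
    (hd : DifferentiableOn ℂ h (ball 0 r)) {x : E} (hx : x ∈ ball (0 : E) r) (n : ℕ) :
    homogeneousPart h n x =
      (2 * Real.pi * Complex.I : ℂ)⁻¹ • ∮ z in C(0, 1), z⁻¹ ^ (n + 1) • h (z • x) := by
  have hdc : DiffContOnCl ℂ (fun z : ℂ => h (z • x)) (ball 0 1) := by
    refine DifferentiableOn.diffContOnCl (hd.comp (by fun_prop) fun z hz => ?_)
    rw [closure_ball _ one_ne_zero, mem_closedBall_zero_iff] at hz
    rw [mem_ball_zero_iff, norm_smul]
    exact lt_of_le_of_lt (mul_le_of_le_one_left (norm_nonneg _) hz) (mem_ball_zero_iff.1 hx)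
  have h1 := hdc.circleIntegral_one_div_sub_center_pow_smul one_pos n
  simp only [sub_zero, one_div] at h1
  simp only [inv_pow]
  rw [h1, smul_smul, homogeneousPart]
  congr 1
  field_simp [Complex.two_pi_I_ne_zero, Nat.factorial_ne_zero]

/-- Differentiation of the Cauchy integral under the integral sign. -/
lemma differentiableAt_circleIntegral {h : E → E} {r M : ℝ}
    (hd : DifferentiableOn ℂ h (ball 0 r)) (hM : ∀ x ∈ ball (0 : E) r, ‖h x‖ ≤ M)
    (n : ℕ) {x : E} (hx : x ∈ ball (0 : E) (r / 2)) :
    DifferentiableAt ℂ (fun x => ∮ z in C(0, 1), z⁻¹ ^ (n + 1) • h (z • x)) x := by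
  have hr : 0 < r := by linarith [pos_of_mem_ball hx]
  have hr2 : r / 2 < r := half_lt_self hr
  have hmem : ∀ y ∈ ball (0 : E) (r / 2), ∀ t : ℝ,
      circleMap 0 1 t • y ∈ ball (0 : E) (r / 2) := by
    intro y hy t
    rw [mem_ball_zero_iff, norm_smul, norm_circleMap_zero, abs_one, one_mul]
    exact mem_ball_zero_iff.1 hy
  have hat : ∀ y ∈ ball (0 : E) (r / 2), ∀ t : ℝ,
      DifferentiableAt ℂ h (circleMap 0 1 t • y) := fun y hy t =>
    hd.differentiableAt (isOpen_ball.mem_nhds (ball_subset_ball hr2.le (hmem y hy t)))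
  have hne : ∀ t : ℝ, circleMap 0 1 t ≠ 0 := fun t => circleMap_ne_center one_ne_zero
  have hcm : Continuous fun t : ℝ => (circleMap 0 1 t)⁻¹ ^ (n + 1) :=
    ((continuous_circleMap 0 1).inv₀ hne).pow _
  have hcd : Continuous (deriv (circleMap 0 1)) := by
    have : deriv (circleMap 0 1) = fun t => circleMap 0 1 t * Complex.I := by
      funext t; exact deriv_circleMap 0 1 t
    rw [this]; fun_prop
  have hFc : ∀ y ∈ ball (0 : E) (r / 2), Continuous fun t : ℝ =>
      deriv (circleMap 0 1) t • (circleMap 0 1 t)⁻¹ ^ (n + 1) • h (circleMap 0 1 t • y) := by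
    intro y hy
    refine hcd.smul (hcm.smul (continuous_iff_continuousAt.2 fun t => ?_))
    exact ContinuousAt.comp' (hat y hy t).continuousAt (by fun_prop)
  have hF'c : Continuous fun t : ℝ => deriv (circleMap 0 1) t • (circleMap 0 1 t)⁻¹ ^ (n + 1) •
      circleMap 0 1 t • fderiv ℂ h (circleMap 0 1 t • x) := by
    refine hcd.smul (hcm.smul ((continuous_circleMap 0 1).smul
      (continuous_iff_continuousAt.2 fun t => ?_)))
    refine ContinuousAt.comp' (g := fderiv ℂ h) (continuousAt_fderiv ?_) (by fun_prop)
    filter_upwards [isOpen_ball.mem_nhds (ball_subset_ball hr2.le (hmem x hx t))] with y hy using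
      hd.differentiableAt (isOpen_ball.mem_nhds hy)
  refine (intervalIntegral.hasFDerivAt_integral_of_dominated_of_fderiv_le
    (F := fun y t => deriv (circleMap 0 1) t • (circleMap 0 1 t)⁻¹ ^ (n + 1) •
      h (circleMap 0 1 t • y))
    (F' := fun y t => deriv (circleMap 0 1) t • (circleMap 0 1 t)⁻¹ ^ (n + 1) •
      circleMap 0 1 t • fderiv ℂ h (circleMap 0 1 t • y))
    (bound := fun _ => 2 * M / (r - r / 2)) (isOpen_ball.mem_nhds hx) ?_
    ((hFc x hx).intervalIntegrable _ _) hF'c.aestronglyMeasurable ?_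
    intervalIntegrable_const ?_).differentiableAt
  · filter_upwards [isOpen_ball.mem_nhds hx] with y hy using (hFc y hy).aestronglyMeasurable
  · refine Eventually.of_forall fun t _ y hy => ?_
    have := norm_fderiv_le_of_mem_closedBall hr2 hd hM (ball_subset_closedBall (hmem y hy t))
    simpa [norm_smul] using this
  · refine Eventually.of_forall fun t _ y hy => ?_
    have h1 : HasFDerivAt (fun y : E => circleMap 0 1 t • y)
        (circleMap 0 1 t • ContinuousLinearMap.id ℂ E) y :=
      (hasFDerivAt_id y).const_smul _
    have h2 := ((hat y hy t).hasFDerivAt.comp y h1)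
    refine ((h2.const_smul _).const_smul _).congr_fderiv ?_
    rw [ContinuousLinearMap.comp_smul, ContinuousLinearMap.comp_id]

lemma differentiable_homogeneousPart [CompleteSpace E] {h : E → E} {r : ℝ} (hr : 0 < r)
    (hd : DifferentiableOn ℂ h (ball 0 r)) (n : ℕ) :
    Differentiable ℂ (homogeneousPart h n) := by
  have hc : ContinuousAt h 0 :=
    (hd.differentiableAt (isOpen_ball.mem_nhds (mem_ball_self hr))).continuousAt
  obtain ⟨s, hs, hball⟩ := Metric.eventually_nhds_iff_ball.1
    (hc.norm.eventually_lt continuousAt_const (lt_add_one ‖h 0‖))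
  set s' := min r s
  have hs' : 0 < s' := lt_min hr hs
  have hd' : DifferentiableOn ℂ h (ball 0 s') := hd.mono (ball_subset_ball (min_le_left _ _))
  have hM : ∀ x ∈ ball (0 : E) s', ‖h x‖ ≤ ‖h 0‖ + 1 := fun x hx =>
    (hball x (ball_subset_ball (min_le_right _ _) hx)).le
  have hnear : ∀ x ∈ ball (0 : E) (s' / 2), DifferentiableAt ℂ (homogeneousPart h n) x := by
    intro x hx
    refine ((differentiableAt_circleIntegral hd' hM n hx).const_smul
      (2 * Real.pi * Complex.I : ℂ)⁻¹).congr_of_eventuallyEq ?_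
    filter_upwards [isOpen_ball.mem_nhds hx] with y hy using
      homogeneousPart_eq_circleIntegral hd' (ball_subset_ball (by linarith) hy) n
  -- homogeneity transports differentiability from a neighbourhood of `0` to the whole space
  intro x
  set c : ℝ := s' / (4 * (‖x‖ + 1))
  have hc0 : 0 < c := by positivity
  have hcC : (c : ℂ) ≠ 0 := by exact_mod_cast hc0.ne'
  have hcx : (c : ℂ) • x ∈ ball (0 : E) (s' / 2) := by
    rw [mem_ball_zero_iff, norm_smul, Complex.norm_real, Real.norm_of_nonneg hc0.le]
    calc c * ‖x‖ ≤ c * (‖x‖ + 1) := by gcongr; linarith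
      _ = s' / 4 := by simp only [c]; field_simp
      _ < s' / 2 := by linarith
  have heq : homogeneousPart h n =
      fun y => ((c : ℂ) ^ n)⁻¹ • homogeneousPart h n ((c : ℂ) • y) := by
    funext y
    rw [homogeneousPart_smul, smul_smul, inv_mul_cancel₀ (pow_ne_zero _ hcC), one_smul]
  rw [heq]
  exact (DifferentiableAt.comp x (hnear _ hcx)
    (differentiableAt_id.const_smul (c : ℂ))).const_smul _

lemma exists_one_lt_mul_lt {t q : ℝ} (h : t < q) : ∃ S : ℝ, 1 < S ∧ S * t < q := by
  have hc : ContinuousAt (fun S : ℝ => S * t) 1 := by fun_prop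
  have hev : ∀ᶠ S : ℝ in 𝓝[>] 1, S * t < q :=
    (hc.eventually_lt continuousAt_const (by simpa using h)).filter_mono nhdsWithin_le_nhds
  obtain ⟨S, h1, h2⟩ := (hev.and self_mem_nhdsWithin).exists
  exact ⟨S, h2, h1⟩

lemma hasSum_homogeneousPart [CompleteSpace E] {h : E → E}
    (hd : DifferentiableOn ℂ h (ball 0 1)) {x : E} (hx : x ∈ ball (0 : E) 1) :
    HasSum (fun n => homogeneousPart h n x) (h x) := by
  have hx' := mem_ball_zero_iff.1 hx
  obtain ⟨R, hR1, hR2⟩ := exists_one_lt_mul_lt hx'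
  have hf : DifferentiableOn ℂ (fun ζ : ℂ => h (ζ • x)) (ball 0 R) := by
    refine hd.comp (by fun_prop) fun z hz => ?_
    rw [mem_ball_zero_iff] at hz ⊢
    rw [norm_smul]
    exact lt_of_le_of_lt (by gcongr) hR2
  have := Complex.hasSum_taylorSeries_on_ball hf (z := 1) (by simpa using hR1)
  simpa [homogeneousPart] using this

/-! ### Norm bounds from numerical range bounds -/

section Homogeneous

variable {P : E → E} {n : ℕ}

lemma exists_norm_le_of_homogeneous (hP : Continuous P)
    (hhom : ∀ (c : ℂ) x, P (c • x) = c ^ n • P x) (R : ℝ) :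
    ∃ C, ∀ x ∈ ball (0 : E) R, ‖P x‖ ≤ C := by
  rcases le_or_gt R 0 with hR | hR
  · exact ⟨0, fun x hx => absurd (pos_of_mem_ball hx) (not_lt.2 hR)⟩
  obtain ⟨s, hs, hball⟩ := Metric.eventually_nhds_iff_ball.1
    (hP.continuousAt.norm.eventually_lt continuousAt_const (lt_add_one ‖P 0‖))
  refine ⟨(R / s) ^ n * (‖P 0‖ + 1), fun x hx => ?_⟩
  have hx' := mem_ball_zero_iff.1 hx
  have hc : ((R / s : ℝ) : ℂ) ≠ 0 := by exact_mod_cast (by positivity : R / s ≠ 0)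
  have h1 := hhom ((R / s : ℝ) : ℂ) (((R / s : ℝ) : ℂ)⁻¹ • x)
  rw [smul_inv_smul₀ hc] at h1
  rw [h1, norm_smul, norm_pow, Complex.norm_real, Real.norm_of_nonneg (by positivity)]
  gcongr
  refine (hball _ ?_).le
  rw [mem_ball_zero_iff, norm_smul, norm_inv, Complex.norm_real,
    Real.norm_of_nonneg (by positivity), inv_div, div_mul_eq_mul_div, div_lt_iff₀ hR]
  gcongr

lemma fderiv_zero_of_homogeneous (hP : Differentiable ℂ P) (hn : 2 ≤ n)
    (hhom : ∀ (c : ℂ) x, P (c • x) = c ^ n • P x) : fderiv ℂ P 0 = 0 := by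
  ext v
  have h1 : HasDerivAt (fun ζ : ℂ => ζ • v) v 0 := by
    simpa using (hasDerivAt_id (0 : ℂ)).smul_const v
  have h2 : HasDerivAt (fun ζ : ℂ => P (ζ • v)) (fderiv ℂ P 0 v) 0 := by
    have := (hP ((0 : ℂ) • v)).hasFDerivAt.comp_hasDerivAt (0 : ℂ) h1
    rwa [zero_smul] at this
  have h3 : HasDerivAt (fun ζ : ℂ => ζ ^ n • P v) ((n * 0 ^ (n - 1) : ℂ) • P v) 0 :=
    (hasDerivAt_pow n (0 : ℂ)).smul_const _
  simp only [hhom] at h2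
  rw [h2.unique h3, zero_pow (by omega), mul_zero, zero_smul]
  rfl

/-- A homogeneous holomorphic map `P` of degree `n ≥ 2` is controlled by its numerical range. The
map `I - λ P`, with `λ = (1 - q) / v`, has an inverse `g` from the ball of radius `q` into the
unit ball. By homogeneity, `λ P (g (ζ y) / ζ) = ζ ^ (-n) (g (ζ y) - ζ y)`, which is at most `2`
in norm for `|ζ| = 1` and equals `λ P y` at `ζ = 0`. -/
theorem norm_le_of_numericalRange_bound [CompleteSpace E] (hP : Differentiable ℂ P)
    (hn : 2 ≤ n) (hhom : ∀ (c : ℂ) x, P (c • x) = c ^ n • P x) {v q : ℝ} (hv : 0 < v)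
    (hq0 : 0 < q) (hq1 : q < 1) (hnum : ∀ x, ∀ φ ∈ J x, ‖φ (P x)‖ ≤ v * ‖x‖ ^ (n + 1))
    {y : E} (hy : y ∈ ball (0 : E) q) : ‖P y‖ ≤ 2 * v / (1 - q) := by
  obtain ⟨C, hC⟩ := exists_norm_le_of_homogeneous hP.continuous hhom 2
  set l : ℝ := (1 - q) / v
  have hl : 0 < l := div_pos (sub_pos.2 hq1) hv
  have hnl : ‖(l : ℂ)‖ = l := by rw [Complex.norm_real, Real.norm_of_nonneg hl.le]
  have hlv : l * v = 1 - q := by simp only [l]; field_simp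
  have hbloch : AreBlochRadii (fun x => x - (l : ℂ) • P x) 1 q := by
    refine areBlochRadii_of_le_re (R := 2) (M := 2 + l * C) one_pos le_rfl (by norm_num) hq0
      (differentiable_id.sub (hP.const_smul (l : ℂ))).differentiableOn (fun x hx => ?_)
      (fun ρ' hρ' => ?_)
    · refine (norm_sub_le _ _).trans ?_
      rw [norm_smul, hnl]
      gcongr
      · exact (mem_ball_zero_iff.1 hx).le
      · exact hC x hx
    · have hc : ContinuousAt (fun t : ℝ => t - (1 - q) * t ^ n) 1 := by fun_prop
      have hev : ∀ᶠ t : ℝ in 𝓝 1, ρ' < t - (1 - q) * t ^ n :=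
        continuousAt_const.eventually_lt hc (by simpa using hρ')
      obtain ⟨e, he, hball⟩ := Metric.eventually_nhds_iff.1 hev
      refine ⟨1 + e, by linarith, fun x hx1 hx2 => ?_⟩
      obtain ⟨φ, hφ⟩ := J_nonempty x
      refine ⟨φ, hφ, ?_⟩
      have h1 : ρ' < ‖x‖ - (1 - q) * ‖x‖ ^ n := hball (by
        rw [Real.dist_eq, abs_of_nonneg (sub_nonneg.2 hx1)]; linarith)
      have h2 : (φ (P x)).re ≤ v * ‖x‖ ^ (n + 1) := (Complex.re_le_norm _).trans (hnum x φ hφ)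
      rw [map_sub, map_smul, Complex.sub_re, re_apply_self_of_mem_J hφ, smul_eq_mul,
        Complex.re_ofReal_mul]
      have h3 : l * (φ (P x)).re ≤ (1 - q) * ‖x‖ ^ (n + 1) := by
        rw [← hlv, mul_assoc]; gcongr
      have h4 : ρ' * ‖x‖ ≤ (‖x‖ - (1 - q) * ‖x‖ ^ n) * ‖x‖ := by gcongr
      rw [pow_succ] at h3
      nlinarith
  obtain ⟨-, -, -, g, hgd, hg⟩ := hbloch
  have hP0 : P 0 = 0 := by
    have := hhom 0 0
    rwa [smul_zero, zero_pow (by omega), zero_smul] at this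
  have hg0 : g 0 = 0 := ((hg 0 (mem_ball_self hq0)).2.2 0 (mem_ball_self one_pos)
    (by simp [hP0])).symm
  have hy' := mem_ball_zero_iff.1 hy
  obtain ⟨S, hS1, hS2⟩ := exists_one_lt_mul_lt hy'
  have hS0 : 0 < S := one_pos.trans hS1
  have hmem : ∀ ζ ∈ ball (0 : ℂ) S, ζ • y ∈ ball (0 : E) q := by
    intro ζ hζ
    rw [mem_ball_zero_iff] at hζ ⊢
    rw [norm_smul]
    exact lt_of_le_of_lt (by gcongr) hS2
  set γ : ℂ → E := fun ζ => g (ζ • y)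
  have hγ0 : γ 0 = 0 := by simp only [γ, zero_smul, hg0]
  have hγd : DifferentiableOn ℂ γ (ball 0 S) := hgd.comp (by fun_prop) hmem
  have hγeq : ∀ ζ ∈ ball (0 : ℂ) S, (l : ℂ) • P (γ ζ) = γ ζ - ζ • y := fun ζ hζ => by
    rw [← (hg _ (hmem ζ hζ)).2.1, sub_sub_cancel]
  have hslope : DifferentiableOn ℂ (dslope γ 0) (ball 0 S) :=
    (Complex.differentiableOn_dslope (ball_mem_nhds _ hS0)).2 hγd
  -- `γ'(0) = y`, because `P'(0) = 0`
  have hderiv : deriv γ 0 = y := by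
    have hγat : HasDerivAt γ (deriv γ 0) 0 :=
      (hγd.differentiableAt (ball_mem_nhds _ hS0)).hasDerivAt
    have h1 : HasDerivAt (fun ζ => (l : ℂ) • P (γ ζ)) ((l : ℂ) • fderiv ℂ P 0 (deriv γ 0)) 0 := by
      have h := (hP (γ 0)).hasFDerivAt.comp_hasDerivAt (0 : ℂ) hγat
      rw [hγ0] at h
      exact h.const_smul _
    have h2 : HasDerivAt (fun ζ => γ ζ - ζ • y) (deriv γ 0 - y) 0 := by
      exact (hγat.sub ((hasDerivAt_id (0 : ℂ)).smul_const y)).congr_deriv (by rw [one_smul])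
    have h3 : (fun ζ => (l : ℂ) • P (γ ζ)) =ᶠ[𝓝 0] fun ζ => γ ζ - ζ • y := by
      filter_upwards [ball_mem_nhds (0 : ℂ) hS0] with ζ hζ using hγeq ζ hζ
    have h4 := h1.unique (h2.congr_of_eventuallyEq h3)
    rw [fderiv_zero_of_homogeneous hP hn hhom, zero_apply, smul_zero] at h4
    exact (sub_eq_zero.1 h4.symm)
  have hk : DiffContOnCl ℂ (fun ζ => (l : ℂ) • P (dslope γ 0 ζ)) (ball 0 1) := by
    refine DifferentiableOn.diffContOnCl ?_
    rw [closure_ball _ one_ne_zero]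
    exact (((hP.differentiableOn (s := univ)).comp (hslope.mono (closedBall_subset_ball hS1))
      (mapsTo_univ _ _)).const_smul (l : ℂ))
  have hmax := Complex.norm_le_of_forall_mem_frontier_norm_le isBounded_ball hk (C := 2)
    (fun ζ hζ => by
      rw [frontier_ball _ one_ne_zero, mem_sphere_zero_iff_norm] at hζ
      have hζS : ζ ∈ ball (0 : ℂ) S := by rw [mem_ball_zero_iff, hζ]; exact hS1
      have h1 : γ ζ = ζ • dslope γ 0 ζ := by
        have := sub_smul_dslope γ 0 ζ
        rw [sub_zero, hγ0, sub_zero] at this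
        exact this.symm
      have h2 : ‖(l : ℂ) • P (γ ζ)‖ = ‖(l : ℂ) • P (dslope γ 0 ζ)‖ := by
        rw [h1, hhom, norm_smul, norm_smul, norm_smul, norm_pow, hζ, one_pow, one_mul]
      rw [← h2, hγeq ζ hζS]
      have h3 := mem_ball_zero_iff.1 (hg _ (hmem ζ hζS)).1
      have h4 := mem_ball_zero_iff.1 (hmem ζ hζS)
      have : ‖γ ζ‖ < 1 := h3
      linarith [norm_sub_le (γ ζ) (ζ • y)])
    (subset_closure (mem_ball_self one_pos))
  rw [dslope_same, hderiv, norm_smul, hnl] at hmax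
  rw [le_div_iff₀ (sub_pos.2 hq1), ← hlv]
  nlinarith

end Homogeneous

/-- The numerical range of a homogeneous part, by the Cauchy estimate on the circle on which
`‖ζ x‖ = r`. -/
lemma norm_apply_homogeneousPart_le [CompleteSpace E] {h : E → E} {r M : ℝ} (hr0 : 0 < r)
    (hr1 : r < 1) (hd : DifferentiableOn ℂ h (ball 0 1))
    (hM : ∀ x, ‖x‖ = r → ∀ φ ∈ J x, ‖φ (h x)‖ ≤ M) (n : ℕ) (x : E) :
    ∀ φ ∈ J x, ‖φ (homogeneousPart h n x)‖ ≤ M / r ^ (n + 1) * ‖x‖ ^ (n + 1) := by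
  intro φ hφ
  rcases eq_or_ne x 0 with rfl | hx
  · have : φ = 0 := by simpa using hφ.2
    simp [this]
  have hx0 : 0 < ‖x‖ := norm_pos_iff.2 hx
  set s := r / ‖x‖
  have hs : 0 < s := by positivity
  have hsx : s * ‖x‖ = r := by simp only [s]; field_simp
  have hmaps : MapsTo (fun ζ : ℂ => ζ • x) (closedBall 0 s) (ball 0 1) := by
    intro ζ hζ
    rw [mem_closedBall_zero_iff] at hζ
    rw [mem_ball_zero_iff, norm_smul]
    refine lt_of_le_of_lt ?_ hr1
    rw [← hsx]
    gcongr
  have hd1 : DifferentiableOn ℂ (fun ζ : ℂ => h (ζ • x)) (closedBall 0 s) :=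
    hd.comp (by fun_prop) hmaps
  have hcd : ContDiffAt ℂ n (fun ζ : ℂ => h (ζ • x)) 0 :=
    (hd1.analyticAt (closedBall_mem_nhds _ hs)).contDiffAt
  have hcomp : φ (iteratedDeriv n (fun ζ : ℂ => h (ζ • x)) 0) =
      iteratedDeriv n (fun ζ : ℂ => φ (h (ζ • x))) 0 := by
    have := φ.iteratedFDeriv_comp_left hcd le_rfl
    rw [iteratedDeriv_eq_iteratedFDeriv, iteratedDeriv_eq_iteratedFDeriv]
    exact (congrArg (fun m => m fun _ => 1) this).symm
  have hcauchy := Complex.norm_iteratedDeriv_le_of_forall_mem_sphere_norm_le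
    (f := fun ζ : ℂ => φ (h (ζ • x))) (c := 0) (C := M / s) n hs
    ((φ.differentiable.comp_differentiableOn hd1).mono
      (by rw [closure_ball _ hs.ne'])).diffContOnCl
    (fun ζ hζ => by
      rw [mem_sphere_zero_iff_norm] at hζ
      have h1 := hM (ζ • x) (by rw [norm_smul, hζ, hsx]) _ (conj_smul_mem_J hφ ζ)
      rw [smul_apply, norm_smul, RCLike.norm_conj, hζ] at h1
      rwa [le_div_iff₀ hs, mul_comm])
  have hf : (0 : ℝ) < n.factorial := by exact_mod_cast n.factorial_pos
  rw [homogeneousPart, map_smul, hcomp, norm_smul, norm_inv, Complex.norm_natCast,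
    inv_mul_le_iff₀ hf]
  refine hcauchy.trans_eq ?_
  simp only [s, div_pow]
  field_simp
  ring

/-- A holomorphic map of the unit ball whose numerical range is bounded on every sphere
of radius `r < 1` is bounded on every smaller concentric ball: its homogeneous parts are bounded
by a geometric series. -/
theorem exists_norm_le_of_numericalRange_bound [CompleteSpace E] {h : E → E}
    (hd : DifferentiableOn ℂ h (ball 0 1))
    (hnum : ∀ r, 0 < r → r < 1 → ∃ M > 0, ∀ x, ‖x‖ = r → ∀ φ ∈ J x, ‖φ (h x)‖ ≤ M)
    {R : ℝ} (hR0 : 0 < R) (hR1 : R < 1) :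
    ∃ C, ∀ x ∈ ball (0 : E) R, ‖h x‖ ≤ C := by
  obtain ⟨r, hRr, hr1⟩ := exists_between hR1
  have hr0 := hR0.trans hRr
  obtain ⟨q, hqR, hq1⟩ := exists_between ((div_lt_one hr0).2 hRr)
  have hq0 : 0 < q := lt_trans (by positivity) hqR
  obtain ⟨M, hM0, hM⟩ := hnum r hr0 hr1
  set a := R / q / r
  have ha0 : 0 < a := by positivity
  have ha1 : a < 1 := by
    simp only [a]
    rw [div_lt_iff₀ hr0] at hqR
    rwa [div_div, div_lt_one (by positivity)]
  have hPd := differentiable_homogeneousPart one_pos hd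
  obtain ⟨C₀, hC₀⟩ := exists_norm_le_of_homogeneous (hPd 0).continuous
    (homogeneousPart_smul h 0) R
  obtain ⟨C₁, hC₁⟩ := exists_norm_le_of_homogeneous (hPd 1).continuous
    (homogeneousPart_smul h 1) R
  have hC₀0 : 0 ≤ C₀ := (norm_nonneg _).trans (hC₀ 0 (mem_ball_self hR0))
  have hC₁0 : 0 ≤ C₁ := (norm_nonneg _).trans (hC₁ 0 (mem_ball_self hR0))
  have hq1' : 0 < 1 - q := sub_pos.2 hq1
  set D := 2 * (M / r) / (1 - q) + C₀ + C₁ / a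
  have hterm : ∀ x ∈ ball (0 : E) R, ∀ n, ‖homogeneousPart h n x‖ ≤ D * a ^ n := by
    intro x hx n
    match n with
    | 0 =>
      refine (hC₀ x hx).trans ?_
      have : 0 ≤ 2 * (M / r) / (1 - q) := by positivity
      have : 0 ≤ C₁ / a := by positivity
      rw [pow_zero, mul_one]
      linarith
    | 1 =>
      refine (hC₁ x hx).trans ?_
      have h1 : 0 ≤ 2 * (M / r) / (1 - q) := by positivity
      have h2 : C₁ / a ≤ D := by linarith
      rwa [pow_one, ← div_le_iff₀ ha0]
    | n + 2 =>
      have hc : ((R / q : ℝ) : ℂ) ≠ 0 := by exact_mod_cast (by positivity : R / q ≠ 0)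
      have hx' : ((R / q : ℝ) : ℂ)⁻¹ • x ∈ ball (0 : E) q := by
        rw [mem_ball_zero_iff, norm_smul, norm_inv, Complex.norm_real,
          Real.norm_of_nonneg (by positivity), inv_div, div_mul_eq_mul_div, div_lt_iff₀ hR0]
        gcongr
        exact mem_ball_zero_iff.1 hx
      have h1 := norm_le_of_numericalRange_bound (hPd (n + 2)) (by omega)
        (homogeneousPart_smul h (n + 2)) (div_pos hM0 (by positivity : 0 < r ^ (n + 2 + 1)))
        hq0 hq1 (norm_apply_homogeneousPart_le hr0 hr1 hd hM (n + 2)) hx'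
      have h2 := homogeneousPart_smul h (n + 2) ((R / q : ℝ) : ℂ) (((R / q : ℝ) : ℂ)⁻¹ • x)
      rw [smul_inv_smul₀ hc] at h2
      rw [h2, norm_smul, norm_pow, Complex.norm_real, Real.norm_of_nonneg (by positivity)]
      calc (R / q) ^ (n + 2) * ‖homogeneousPart h (n + 2) (((R / q : ℝ) : ℂ)⁻¹ • x)‖
          ≤ (R / q) ^ (n + 2) * (2 * (M / r ^ (n + 2 + 1)) / (1 - q)) := by gcongr
        _ = 2 * (M / r) / (1 - q) * a ^ (n + 2) := by
          simp only [a]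
          rw [div_pow (R / q) r, pow_succ r (n + 2)]
          field_simp
        _ ≤ D * a ^ (n + 2) := by
          have : 0 ≤ C₁ / a := by positivity
          gcongr
          linarith
  refine ⟨D * (1 - a)⁻¹, fun x hx => ?_⟩
  have hxs := hasSum_homogeneousPart hd (ball_subset_ball hR1.le hx)
  rw [← hxs.tsum_eq]
  exact tsum_of_norm_bounded ((hasSum_geometric_of_lt_one ha0.le ha1).mul_left D) (hterm x hx)

end HolomorphicMaps

/-! ### Carathéodory's inequality on the unit disc -/

/-- Maximum principle for the harmonic function `Re f`, applied through `|exp f|` on circles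
of radius tending to `1`. -/
lemma re_le_of_sq_norm_mul_re_le {f : ℂ → ℂ} {N : ℝ} (hf : DifferentiableOn ℂ f (ball 0 1))
    (hN : ∀ z ∈ ball (0 : ℂ) 1, z ≠ 0 → ‖z‖ ^ 2 * (f z).re ≤ N) {z : ℂ}
    (hz : z ∈ ball (0 : ℂ) 1) : (f z).re ≤ N := by
  by_contra! hcon
  have hc : ContinuousAt (fun s : ℝ => s ^ 2 * (f z).re) 1 := by fun_prop
  have hev : ∀ᶠ s : ℝ in 𝓝[<] 1, N < s ^ 2 * (f z).re :=
    (continuousAt_const.eventually_lt hc (by simpa using hcon)).filter_mono nhdsWithin_le_nhds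
  obtain ⟨s, hs, hzs, hs1⟩ :=
    (hev.and (Ioo_mem_nhdsLT (mem_ball_zero_iff.1 hz))).exists
  have hs0 : 0 < s := (norm_nonneg z).trans_lt hzs
  have hd : DiffContOnCl ℂ (fun ζ => Complex.exp (f ζ)) (ball 0 s) := by
    refine DifferentiableOn.diffContOnCl ?_
    rw [closure_ball _ hs0.ne']
    exact (hf.mono (closedBall_subset_ball hs1)).cexp
  have hmax := Complex.norm_le_of_forall_mem_frontier_norm_le isBounded_ball hd
    (C := Real.exp (N / s ^ 2)) (fun ζ hζ => by
      rw [frontier_ball _ hs0.ne', mem_sphere_zero_iff_norm] at hζ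
      rw [Complex.norm_exp, Real.exp_le_exp, le_div_iff₀ (by positivity), mul_comm, ← hζ]
      exact hN ζ (by rwa [mem_ball_zero_iff, hζ]) (norm_pos_iff.1 (hζ ▸ hs0)))
    (subset_closure (mem_ball_zero_iff.2 hzs))
  rw [Complex.norm_exp, Real.exp_le_exp, le_div_iff₀ (by positivity), mul_comm] at hmax
  linarith

/-- The Schwarz lemma for the Cayley transform `(f - f(0)) / (2m - (f - f(0)))` of a function
with real part bounded above, where `m` is the bound for `Re (f - f(0))`. -/
lemma norm_sub_le_mul_norm_sub_of_re_le {f : ℂ → ℂ} {N : ℝ}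
    (hf : DifferentiableOn ℂ f (ball 0 1)) (hN : ∀ z ∈ ball (0 : ℂ) 1, (f z).re ≤ N)
    {z : ℂ} (hz : z ∈ ball (0 : ℂ) 1) :
    ‖f z - f 0‖ ≤ ‖z‖ * ‖((2 * (N - (f 0).re) : ℝ) : ℂ) - (f z - f 0)‖ := by
  have h0N := hN 0 (mem_ball_self one_pos)
  -- a slightly larger bound keeps the denominator away from zero
  have key : ∀ N' > N, ‖f z - f 0‖ ≤
      ‖z‖ * ‖((2 * (N' - (f 0).re) : ℝ) : ℂ) - (f z - f 0)‖ := by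
    intro N' hN'
    set m := N' - (f 0).re
    have hm : 0 < m := by simp only [m]; linarith
    have hre : ∀ ζ ∈ ball (0 : ℂ) 1, (f ζ - f 0).re ≤ m := fun ζ hζ => by
      rw [Complex.sub_re]; simp only [m]; linarith [hN ζ hζ]
    have hne : ∀ ζ ∈ ball (0 : ℂ) 1, ((2 * m : ℝ) : ℂ) - (f ζ - f 0) ≠ 0 := by
      intro ζ hζ h
      have h1 := congrArg Complex.re h
      rw [Complex.sub_re, Complex.ofReal_re, Complex.zero_re] at h1
      linarith [hre ζ hζ]
    have hle : ∀ ζ ∈ ball (0 : ℂ) 1, ‖f ζ - f 0‖ ≤ ‖((2 * m : ℝ) : ℂ) - (f ζ - f 0)‖ := by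
      intro ζ hζ
      rw [← sq_le_sq₀ (norm_nonneg _) (norm_nonneg _), Complex.sq_norm, Complex.sq_norm,
        Complex.normSq_apply, Complex.normSq_apply, Complex.sub_re (((2 * m : ℝ) : ℂ)),
        Complex.sub_im (((2 * m : ℝ) : ℂ)), Complex.ofReal_re, Complex.ofReal_im]
      nlinarith [mul_nonneg hm.le (sub_nonneg.2 (hre ζ hζ))]
    have hschwarz := Complex.norm_le_norm_of_mapsTo_ball
      (f := fun ζ => (f ζ - f 0) / (((2 * m : ℝ) : ℂ) - (f ζ - f 0))) (R := 1) (z := z)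
      ((hf.sub_const _).div ((differentiableOn_const _).sub (hf.sub_const _)) hne)
      (fun ζ hζ => by
        rw [mem_closedBall_zero_iff, norm_div]
        exact div_le_one_of_le₀ (hle ζ hζ) (norm_nonneg _))
      (by simp) (mem_ball_zero_iff.1 hz)
    rwa [norm_div, div_le_iff₀ (norm_pos_iff.2 (hne z hz))] at hschwarz
  have hc : ContinuousAt (fun N' : ℝ =>
      ‖z‖ * ‖((2 * (N' - (f 0).re) : ℝ) : ℂ) - (f z - f 0)‖) N := by fun_prop
  exact ge_of_tendsto (hc.mono_left (nhdsWithin_le_nhds (s := Ioi N)))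
    (eventually_nhdsWithin_of_forall key)

/-- The condition on `d` describes a disc with centre `-c r² / (1 - r²)` and
radius `c r / (1 - r²)`; the estimate is its support function in the direction `e^{iθ}`. -/
lemma re_exp_mul_le_of_norm_le {d : ℂ} {c r θ : ℝ} (hc : 0 ≤ c) (hr0 : 0 ≤ r) (hr1 : r < 1)
    (h : ‖d‖ ≤ r * ‖(c : ℂ) - d‖) :
    (Complex.exp (-(θ * Complex.I)) * d).re ≤ c * (r * (1 - r * Real.cos θ) / (1 - r ^ 2)) := by
  have hr2 : 0 < 1 - r ^ 2 := by nlinarith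
  have h1 : ‖d‖ ^ 2 ≤ r ^ 2 * ‖(c : ℂ) - d‖ ^ 2 := by
    rw [← mul_pow]; gcongr
  rw [Complex.sq_norm, Complex.sq_norm, Complex.normSq_apply, Complex.normSq_apply,
    Complex.sub_re, Complex.sub_im, Complex.ofReal_re, Complex.ofReal_im] at h1
  have hexp : (Complex.exp (-(θ * Complex.I)) * d).re = Real.cos θ * d.re + Real.sin θ * d.im := by
    have : Complex.exp (-(θ * Complex.I)) = Complex.exp (((-θ : ℝ) : ℂ) * Complex.I) := by
      push_cast; ring_nf
    rw [this, Complex.mul_re, Complex.exp_ofReal_mul_I_re, Complex.exp_ofReal_mul_I_im,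
      Real.cos_neg, Real.sin_neg]
    ring
  rw [hexp]
  set x := d.re
  set y := d.im
  set m := c * r ^ 2 / (1 - r ^ 2) with hm
  have hdisc : (x + m) ^ 2 + y ^ 2 ≤ (c * r / (1 - r ^ 2)) ^ 2 := by
    have e : (c * r / (1 - r ^ 2)) ^ 2 - ((x + m) ^ 2 + y ^ 2) =
        (r ^ 2 * ((c - x) * (c - x) + (0 - y) * (0 - y)) - (x * x + y * y)) / (1 - r ^ 2) := by
      rw [hm]; field_simp; ring
    have := div_nonneg (sub_nonneg.2 h1) hr2.le
    linarith
  have hcs : (Real.cos θ * (x + m) + Real.sin θ * y) ^ 2 ≤ (c * r / (1 - r ^ 2)) ^ 2 := by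
    refine le_trans ?_ hdisc
    nlinarith [sq_nonneg (Real.cos θ * y - Real.sin θ * (x + m)), Real.sin_sq_add_cos_sq θ]
  have hle := abs_le_of_sq_le_sq' hcs (by positivity)
  have e : c * (r * (1 - r * Real.cos θ) / (1 - r ^ 2)) =
      c * r / (1 - r ^ 2) - m * Real.cos θ := by
    rw [hm]; field_simp
  rw [e]
  linarith [hle.2]

lemma norm_le_of_norm_le_mul_norm_sub {d : ℂ} {c r : ℝ} (hc : 0 ≤ c) (hr0 : 0 ≤ r) (hr1 : r < 1)
    (h : ‖d‖ ≤ r * ‖(c : ℂ) - d‖) : ‖d‖ ≤ c * (r / (1 - r)) := by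
  have h1 : ‖(c : ℂ) - d‖ ≤ c + ‖d‖ := by
    have := norm_sub_le (c : ℂ) d
    rwa [Complex.norm_real, Real.norm_of_nonneg hc] at this
  have h2 := h.trans (mul_le_mul_of_nonneg_left h1 hr0)
  rw [mul_div_assoc', le_div_iff₀ (sub_pos.2 hr1)]
  linarith

/-! ### The growth of the numerical range -/

section NumericalRange

variable {X : Type*} [NormedAddCommGroup X] [NormedSpace ℂ X] {h : X → X} {θ : ℝ}

lemma norm_apply_fderiv_le {u : X} (hu : ‖u‖ = 1) {φ : StrongDual ℂ X} (hφ : φ ∈ J u) :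
    ‖φ (fderiv ℂ h 0 u)‖ ≤ ‖fderiv ℂ h 0‖ := by
  refine (norm_apply_le_of_mem_J hφ _).trans ?_
  rw [hu, one_mul]
  exact ((fderiv ℂ h 0).le_opNorm u).trans (by rw [hu, mul_one])

lemma abs_le_of_mem_reRange_sphere {t : ℝ}
    (ht : t ∈ reRange (sphere 0 1) θ (fun x => fderiv ℂ h 0 x)) : |t| ≤ ‖fderiv ℂ h 0‖ := by
  obtain ⟨u, hu, φ, hφ, rfl⟩ := ht
  refine (Complex.abs_re_le_norm _).trans ?_
  rw [map_smul, norm_smul, Complex.norm_exp_ofReal_mul_I, one_mul]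
  exact norm_apply_fderiv_le (mem_sphere_zero_iff_norm.1 hu) hφ

lemma re_apply_fderiv_le_upperL {u : X} (hu : ‖u‖ = 1) {φ : StrongDual ℂ X} (hφ : φ ∈ J u) :
    (φ (fderiv ℂ h 0 u)).re ≤ upperL h 0 := by
  refine le_csSup ⟨‖fderiv ℂ h 0‖, fun t ht => (le_abs_self t).trans
    (abs_le_of_mem_reRange_sphere ht)⟩ ⟨u, mem_sphere_zero_iff_norm.2 hu, φ, hφ, ?_⟩
  simp

lemma lowerL_le_re {u : X} (hu : ‖u‖ = 1) {φ : StrongDual ℂ X} (hφ : φ ∈ J u) :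
    lowerL h θ ≤ (Complex.exp (θ * Complex.I) * φ (fderiv ℂ h 0 u)).re := by
  refine csInf_le ⟨-‖fderiv ℂ h 0‖, fun t ht => (abs_le.1 (abs_le_of_mem_reRange_sphere ht)).1⟩
    ⟨u, mem_sphere_zero_iff_norm.2 hu, φ, hφ, ?_⟩
  rw [map_smul, smul_eq_mul]

lemma re_le_upperN (hN : BddAbove (reRange (ball 0 1) θ h)) {x : X} (hx : x ∈ ball (0 : X) 1)
    {φ : StrongDual ℂ X} (hφ : φ ∈ J x) :
    (Complex.exp (θ * Complex.I) * φ (h x)).re ≤ upperN h θ :=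
  le_csSup hN ⟨x, hx, φ, hφ, by rw [map_smul, smul_eq_mul]⟩

/-- Restriction of `h` to the complex line through `x`: the function `f(z) = ⟨h(z u), u*⟩ / z` on
the unit disc satisfies `Re (e^{iθ} f) ≤ N(θ)`, and Carathéodory's inequality compares `f(‖x‖)`
with `f(0) = ⟨h'(0) u, u*⟩`. -/
lemma exists_apply_eq (hh : DifferentiableOn ℂ h (ball 0 1)) (h0 : h 0 = 0)
    (hN : BddAbove (reRange (ball 0 1) θ h)) {x : X} (hx : x ∈ ball (0 : X) 1) (hx0 : x ≠ 0)
    {ψ : StrongDual ℂ X} (hψ : ψ ∈ J x) :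
    ∃ (b d : ℂ) (c : ℝ),
      ψ (h x) = ((‖x‖ ^ 2 : ℝ) : ℂ) * (b + Complex.exp (-(θ * Complex.I)) * d) ∧
      ‖b‖ ≤ ‖fderiv ℂ h 0‖ ∧ b.re ≤ upperL h 0 ∧ 0 ≤ c ∧
      c ≤ 2 * (upperN h θ - lowerL h θ) ∧ ‖d‖ ≤ ‖x‖ * ‖(c : ℂ) - d‖ := by
  have hnx : 0 < ‖x‖ := norm_pos_iff.2 hx0
  have hnC : (‖x‖ : ℂ) ≠ 0 := by exact_mod_cast hnx.ne'
  have hx1 := mem_ball_zero_iff.1 hx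
  set u : X := (‖x‖ : ℂ)⁻¹ • x
  have hxu : (‖x‖ : ℂ) • u = x := smul_inv_smul₀ hnC x
  have hu : ‖u‖ = 1 := by
    simp only [u]
    rw [norm_smul, norm_inv, Complex.norm_real, norm_norm, inv_mul_cancel₀ hnx.ne']
  obtain ⟨φ, hφ, hφψ⟩ : ∃ φ ∈ J u, ψ = (‖x‖ : ℂ) • φ := by
    refine ⟨(‖x‖ : ℂ)⁻¹ • ψ, ?_, (smul_inv_smul₀ hnC ψ).symm⟩
    have := conj_smul_mem_J hψ (‖x‖ : ℂ)⁻¹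
    rwa [map_inv₀, Complex.conj_ofReal] at this
  have hmem : ∀ z ∈ ball (0 : ℂ) 1, z • u ∈ ball (0 : X) 1 := fun z hz => by
    rw [mem_ball_zero_iff] at hz ⊢
    rwa [norm_smul, hu, mul_one]
  set k : ℂ → ℂ := fun z => φ (h (z • u))
  have hk0 : k 0 = 0 := by simp only [k, zero_smul, h0, map_zero]
  have hkd : DifferentiableOn ℂ k (ball 0 1) :=
    φ.differentiable.comp_differentiableOn (hh.comp (by fun_prop) hmem)
  have hfd : DifferentiableOn ℂ (dslope k 0) (ball 0 1) :=
    (Complex.differentiableOn_dslope (ball_mem_nhds _ one_pos)).2 hkd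
  have hfk : ∀ z, k z = z * dslope k 0 z := fun z => by
    have := sub_smul_dslope k 0 z
    rw [sub_zero, hk0, sub_zero, smul_eq_mul] at this
    exact this.symm
  have hf0 : dslope k 0 0 = φ (fderiv ℂ h 0 u) := by
    rw [dslope_same]
    have h1 : HasDerivAt (fun ζ : ℂ => ζ • u) u 0 := by
      simpa using (hasDerivAt_id (0 : ℂ)).smul_const u
    have h2 : HasFDerivAt h (fderiv ℂ h 0) ((0 : ℂ) • u) := by
      rw [zero_smul]
      exact (hh.differentiableAt (ball_mem_nhds _ one_pos)).hasFDerivAt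
    exact (φ.hasFDerivAt.comp_hasDerivAt (0 : ℂ) (h2.comp_hasDerivAt (0 : ℂ) h1)).deriv
  set e := Complex.exp (θ * Complex.I)
  have he : Complex.exp (-(θ * Complex.I)) * e = 1 := by
    rw [← Complex.exp_add, neg_add_cancel, Complex.exp_zero]
  have hgd : DifferentiableOn ℂ (fun z => e * dslope k 0 z) (ball 0 1) := hfd.const_mul e
  have hgN : ∀ z ∈ ball (0 : ℂ) 1, (e * dslope k 0 z).re ≤ upperN h θ := fun z hz =>
    re_le_of_sq_norm_mul_re_le hgd (fun z hz _ => by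
      have h1 := re_le_upperN hN (hmem z hz) (conj_smul_mem_J hφ z)
      rw [smul_apply, smul_eq_mul, show φ (h (z • u)) = z * dslope k 0 z from hfk z,
        ← mul_assoc, ← mul_assoc, mul_comm e, mul_assoc (_ * e), mul_comm _ e] at h1
      have h2 : ∀ w : ℂ, e * (starRingEnd ℂ) z * (z * w) = ((‖z‖ ^ 2 : ℝ) : ℂ) * (e * w) := by
        intro w
        rw [Complex.sq_norm, Complex.normSq_eq_conj_mul_self]
        ring
      rwa [h2, Complex.re_ofReal_mul] at h1) hz
  have hxz : (‖x‖ : ℂ) ∈ ball (0 : ℂ) 1 := by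
    rwa [mem_ball_zero_iff, Complex.norm_real, norm_norm]
  have hcar := norm_sub_le_mul_norm_sub_of_re_le hgd hgN hxz
  rw [Complex.norm_real, norm_norm, hf0] at hcar
  have hlow := lowerL_le_re (h := h) (θ := θ) hu hφ
  have hup := hgN 0 (mem_ball_self one_pos)
  rw [hf0] at hup
  refine ⟨φ (fderiv ℂ h 0 u), e * dslope k 0 (‖x‖ : ℂ) - e * φ (fderiv ℂ h 0 u), _, ?_,
    norm_apply_fderiv_le hu hφ, re_apply_fderiv_le_upperL hu hφ, ?_, ?_, hcar⟩
  · have h1 : φ (h x) = ‖x‖ * dslope k 0 (‖x‖ : ℂ) := by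
      rw [← hfk]; simp only [k, hxu]
    rw [hφψ, smul_apply, smul_eq_mul, h1]
    push_cast
    linear_combination
      -((‖x‖ : ℂ) ^ 2 * (dslope k 0 (‖x‖ : ℂ) - φ (fderiv ℂ h 0 u))) * he
  · linarith
  · linarith

/-- The growth estimate `Re ⟨h(x), x*⟩ ≤ ‖x‖² (L + Q(‖x‖))`. -/
theorem re_apply_le (hh : DifferentiableOn ℂ h (ball 0 1)) (h0 : h 0 = 0)
    (hN : BddAbove (reRange (ball 0 1) θ h)) {x : X} (hx : x ∈ ball (0 : X) 1) (hx0 : x ≠ 0)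
    {ψ : StrongDual ℂ X} (hψ : ψ ∈ J x) :
    (ψ (h x)).re ≤ ‖x‖ ^ 2 * (upperL h 0 + Q (upperN h θ - lowerL h θ) θ ‖x‖) := by
  obtain ⟨b, d, c, heq, -, hb, hc0, hc, hd⟩ := exists_apply_eq hh h0 hN hx hx0 hψ
  have hx1 := mem_ball_zero_iff.1 hx
  have h1 := re_exp_mul_le_of_norm_le (θ := θ) hc0 (norm_nonneg x) hx1 hd
  have h2 : 0 ≤ ‖x‖ * (1 - ‖x‖ * Real.cos θ) / (1 - ‖x‖ ^ 2) := by
    refine div_nonneg (mul_nonneg (norm_nonneg x) ?_) ?_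
    · nlinarith [Real.cos_le_one θ, norm_nonneg x]
    · nlinarith [norm_nonneg x]
  have h3 := mul_le_mul_of_nonneg_right hc h2
  have hQ : Q (upperN h θ - lowerL h θ) θ ‖x‖ = 2 * (upperN h θ - lowerL h θ) *
      (‖x‖ * (1 - ‖x‖ * Real.cos θ) / (1 - ‖x‖ ^ 2)) := by
    unfold Q; ring
  rw [heq, Complex.re_ofReal_mul, Complex.add_re, hQ]
  gcongr
  exact h1.trans h3

/-- On each sphere of radius less than `1` the numerical range of `h` is bounded in modulus. -/
theorem norm_apply_le (hh : DifferentiableOn ℂ h (ball 0 1)) (h0 : h 0 = 0)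
    (hN : BddAbove (reRange (ball 0 1) θ h)) {x : X} (hx : x ∈ ball (0 : X) 1) (hx0 : x ≠ 0)
    {ψ : StrongDual ℂ X} (hψ : ψ ∈ J x) :
    ‖ψ (h x)‖ ≤ ‖x‖ ^ 2 * (‖fderiv ℂ h 0‖ +
      2 * (upperN h θ - lowerL h θ) * (‖x‖ / (1 - ‖x‖))) := by
  obtain ⟨b, d, c, heq, hb, -, hc0, hc, hd⟩ := exists_apply_eq hh h0 hN hx hx0 hψ
  have hx1 := mem_ball_zero_iff.1 hx
  have h1 := norm_le_of_norm_le_mul_norm_sub hc0 (norm_nonneg x) hx1 hd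
  have h2 : 0 ≤ ‖x‖ / (1 - ‖x‖) := div_nonneg (norm_nonneg x) (sub_pos.2 hx1).le
  have h3 := mul_le_mul_of_nonneg_right hc h2
  have he : ‖Complex.exp (-(θ * Complex.I))‖ = 1 := by
    have : -((θ : ℂ) * Complex.I) = ((-θ : ℝ) : ℂ) * Complex.I := by push_cast; ring
    rw [this, Complex.norm_exp_ofReal_mul_I]
  rw [heq, norm_mul, Complex.norm_real, Real.norm_of_nonneg (by positivity)]
  gcongr
  refine (norm_add_le _ _).trans ?_
  rw [norm_mul, he, one_mul]
  linarith

/-! ### Bloch radii of `I - h` -/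

/-- The growth estimate says that `Re ⟨x - h(x), x*⟩ ≥ ‖x‖ ρ(‖x‖)`, and continuity of `ρ` makes this
nearly `‖x‖ ρ(r)` in a thin shell outside the sphere of radius `r`. -/
theorem areBlochRadii_rho [CompleteSpace X] (hh : DifferentiableOn ℂ h (ball 0 1)) (h0 : h 0 = 0)
    (hN : BddAbove (reRange (ball 0 1) θ h)) (hL1 : upperL h 0 < 1)
    (hδ0 : 0 < upperN h θ - lowerL h θ) (hc : Real.cos θ < 1) {r : ℝ} (hr0 : 0 < r)
    (hr : r < rStar (upperL h 0) (upperN h θ - lowerL h θ) θ) :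
    AreBlochRadii (fun x => x - h x) r
      (rho (upperL h 0) (upperN h θ - lowerL h θ) θ r) := by
  have hr1 := hr.trans (rStar_lt_one hL1 hδ0 hc)
  have hρ := rho_pos hL1 hδ0 hc hr0 hr
  obtain ⟨R, hrR, hR1⟩ := exists_between hr1
  obtain ⟨C, hC⟩ := exists_norm_le_of_numericalRange_bound hh (fun s hs0 hs1 => by
    refine ⟨s ^ 2 * (‖fderiv ℂ h 0‖ + 2 * (upperN h θ - lowerL h θ) * (s / (1 - s))), ?_,
      fun x hx φ hφ => ?_⟩
    · have := sub_pos.2 hs1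
      positivity
    · subst hx
      exact norm_apply_le hh h0 hN (mem_ball_zero_iff.2 hs1) (norm_pos_iff.1 hs0) hφ)
    (hr0.trans hrR) hR1
  refine areBlochRadii_of_le_re (R := R) (M := R + C) hr0 hr1.le hrR hρ
    (differentiableOn_id.sub (hh.mono (ball_subset_ball hR1.le)))
    (fun x hx => (norm_sub_le _ _).trans (add_le_add (mem_ball_zero_iff.1 hx).le (hC x hx)))
    (fun ρ' hρ' => ?_)
  have hcont : ContinuousAt (rho (upperL h 0) (upperN h θ - lowerL h θ) θ) r :=
    (hasDerivAt_rho hr0 hr1).continuousAt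
  have hev := (continuousAt_const.eventually_lt hcont hρ').and (eventually_lt_nhds hr1)
  obtain ⟨ε, hε, hball⟩ := Metric.eventually_nhds_iff.1 hev
  refine ⟨r + ε, by linarith, fun x hx1 hx2 => ?_⟩
  obtain ⟨φ, hφ⟩ := J_nonempty x
  obtain ⟨h1, h2⟩ := hball (y := ‖x‖) (by
    rw [Real.dist_eq, abs_of_nonneg (sub_nonneg.2 hx1)]; linarith)
  have hx0 : 0 < ‖x‖ := hr0.trans_le hx1
  refine ⟨φ, hφ, ?_⟩
  have h3 := re_apply_le hh h0 hN (mem_ball_zero_iff.2 h2) (norm_pos_iff.1 hx0) hφ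
  rw [rho_eq_mul_sub_Q hx0.le h2] at h1
  rw [map_sub, Complex.sub_re, re_apply_self_of_mem_J hφ]
  have h4 := mul_lt_mul_of_pos_right h1 hx0
  nlinarith

end NumericalRange

end BlochRadii

open BlochRadii in
theorem mainTheorem6 {X : Type*} [NormedAddCommGroup X] [NormedSpace ℂ X] [CompleteSpace X]
    [Nontrivial X] (h : X → X) (θ L δ : ℝ)
    (hh : DifferentiableOn ℂ h (Metric.ball 0 1)) (h0 : h 0 = 0)
    (hN : BddAbove (BlochRadii.reRange (Metric.ball 0 1) θ h))
    (hL : L = BlochRadii.upperL h 0)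
    (hδ : δ = BlochRadii.upperN h θ - BlochRadii.lowerL h θ)
    (hL1 : L < 1) (hδ0 : 0 < δ) (hθ : Real.cos θ ≠ 1) :
    -- the numbers `r_*` and `s_*`
    (BlochRadii.rStar L δ θ ∈ Set.Ioo (0 : ℝ) 1 ∧
      ∀ r ∈ Set.Ioo (0 : ℝ) 1, BlochRadii.rho L δ θ r = 0 ↔ r = BlochRadii.rStar L δ θ) ∧
    (BlochRadii.sStar L δ θ ∈ Set.Ioo 0 (BlochRadii.rStar L δ θ) ∧
      ∀ s ∈ Set.Ioo (0 : ℝ) 1, BlochRadii.A L δ θ s = 0 ↔ s = BlochRadii.sStar L δ θ) ∧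
    -- the Bloch radii `(r, ρ(r))` and the maximum of `ρ`
    (∀ r ∈ Set.Ioo 0 (BlochRadii.rStar L δ θ),
      BlochRadii.AreBlochRadii (fun x => x - h x) r (BlochRadii.rho L δ θ r)) ∧
    (∃ r₀ ∈ Set.Ioo 0 (BlochRadii.rStar L δ θ),
      (∀ r ∈ Set.Ioo 0 (BlochRadii.rStar L δ θ),
        HasDerivAt (BlochRadii.rho L δ θ) 0 r ↔ r = r₀) ∧
      IsMaxOn (BlochRadii.rho L δ θ) (Set.Ioo 0 1) r₀) ∧
    -- the Bloch radii `(r, ρ_s(r))`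
    (∀ s ∈ Set.Ioo 0 (BlochRadii.rStar L δ θ),
      (∀ r ∈ Set.Ioo 0 (BlochRadii.rStar L δ θ), 0 < BlochRadii.rhoS L δ θ s r) ∧
      (∀ r ∈ Set.Ioc 0 s, BlochRadii.rhoS L δ θ s r ≤ BlochRadii.rho L δ θ r) ∧
      ((∀ r ∈ Set.Ioc 0 s, BlochRadii.rhoS L δ θ s r ≤ BlochRadii.rho L δ θ s) ↔
        BlochRadii.Q δ θ s ≤ 2 / 3 * (1 - L)) ∧
      BlochRadii.rhoS L δ θ s s = BlochRadii.rho L δ θ s ∧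
      (∀ r ∈ Set.Ioc 0 s,
        BlochRadii.AreBlochRadii (fun x => x - h x) r (BlochRadii.rhoS L δ θ s r))) ∧
    -- (a)
    (∀ r : ℝ, 0 < r →
      r / BlochRadii.rhoS L δ θ (BlochRadii.sStar L δ θ) r =
        (BlochRadii.sStar L δ θ + r) / (BlochRadii.sStar L δ θ * (1 - L))) ∧
    -- (b)
    (∀ s ∈ Set.Ioo 0 (BlochRadii.sStar L δ θ),
      StrictMonoOn (BlochRadii.rhoS L δ θ s) (Set.Ioc 0 s) ∧
      IsGreatest (BlochRadii.rhoS L δ θ s '' Set.Ioc 0 s) (BlochRadii.rhoS L δ θ s s) ∧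
      BlochRadii.rhoS L δ θ s s = BlochRadii.rho L δ θ s ∧
      BlochRadii.rho L δ θ s =
        (1 - L) * s - 2 * δ * s ^ 2 * (1 - s * Real.cos θ) / (1 - s ^ 2)) ∧
    -- (c)
    (∀ s ∈ Set.Ioo (BlochRadii.sStar L δ θ) (BlochRadii.rStar L δ θ),
      (2 / 3 * (1 - L) < BlochRadii.Q δ θ s →
        BlochRadii.rZero L δ θ s ∈ Set.Ioo 0 s ∧
        IsGreatest (BlochRadii.rhoS L δ θ s '' Set.Ioc 0 s)
          (BlochRadii.rhoS L δ θ s (BlochRadii.rZero L δ θ s))) ∧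
      (BlochRadii.Q δ θ s ≤ 2 / 3 * (1 - L) →
        IsGreatest (BlochRadii.rhoS L δ θ s '' Set.Ioc 0 s) (BlochRadii.rho L δ θ s))) := by
  subst hL hδ
  have hc : Real.cos θ < 1 := lt_of_le_of_ne (Real.cos_le_one θ) hθ
  set L := upperL h 0
  set δ := upperN h θ - lowerL h θ
  have hr1 : rStar L δ θ < 1 := rStar_lt_one hL1 hδ0 hc
  have hr0 : 0 < rStar L δ θ := rStar_pos hL1 hδ0 hc
  have hs0 : 0 < sStar L δ θ := sStar_pos hL1 hδ0 hc
  have hsr : sStar L δ θ < rStar L δ θ := sStar_lt_rStar hL1 hδ0 hc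
  have hbloch : ∀ r ∈ Set.Ioo 0 (rStar L δ θ),
      AreBlochRadii (fun x => x - h x) r (rho L δ θ r) := fun r hr =>
    areBlochRadii_rho hh h0 hN hL1 hδ0 hc hr.1 hr.2
  refine ⟨⟨⟨hr0, hr1⟩, fun r hr => ?_⟩, ⟨⟨hs0, hsr⟩, fun s hs =>
    A_eq_zero_iff hL1 hδ0 hc hs.1.le hs.2⟩, hbloch, exists_rho_max hL1 hδ0 hc,
    fun s hs => ?_, fun r hr => ?_, fun s hs => ?_, fun s hs => ?_⟩
  · rw [rho_eq_mul_sub_Q hr.1.le hr.2, mul_eq_zero, or_iff_right hr.1.ne', sub_eq_zero,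
      eq_comm, Q_eq_iff hL1 hδ0 hc hr.1.le hr.2]
  · have hs1 := hs.2.trans hr1
    refine ⟨fun r hr => rhoS_pos hL1 hδ0 hc hs.1 hs.2 hr.1 hr.2,
      fun r hr => rhoS_le_rho hδ0 hs1 hr.1 hr.2, forall_rhoS_le_iff hL1 hδ0 hc hs.1 hs.2,
      rhoS_self hs.1 hs1, fun r hr => ?_⟩
    have hr' : r ∈ Set.Ioo 0 (rStar L δ θ) := ⟨hr.1, hr.2.trans_lt hs.2⟩
    exact (hbloch r hr').mono (rhoS_pos hL1 hδ0 hc hs.1 hs.2 hr'.1 hr'.2)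
      (rhoS_le_rho hδ0 hs1 hr.1 hr.2)
  · have hA := (A_eq_zero_iff hL1 hδ0 hc hs0.le (hsr.trans hr1)).2 rfl
    have ha : 1 - L ≠ 0 := (sub_pos.2 hL1).ne'
    have hsr' : sStar L δ θ + r ≠ 0 := (add_pos hs0 hr).ne'
    rw [rhoS, hA, B]
    field_simp
    ring
  · have hs1 := (hs.2.trans hsr).trans hr1
    have hA := ((A_pos_iff hL1 hδ0 hc hs.1.le hs1).2 hs.2).le
    refine ⟨rhoS_strictMonoOn hL1 hs.1 hA, isGreatest_rhoS_self hL1 hs.1 hA,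
      rhoS_self hs.1 hs1, ?_⟩
    rw [rho_eq_mul_sub_Q hs.1.le hs1, Q]
    ring
  · have hs0' := hs0.trans hs.1
    have hs1 := hs.2.trans hr1
    refine ⟨fun hQ => ?_, fun hQ => ?_⟩
    · have hmem := rZero_mem_Ioo hL1 hs0' hQ
      refine ⟨hmem, ⟨_, ⟨hmem.1, hmem.2.le⟩, rfl⟩, ?_⟩
      rintro _ ⟨r, hr, rfl⟩
      refine rhoS_le_rhoS_rZero hs0' hr.1 (Q_pos hδ0 hs0' hs1) ?_
      unfold A
      linarith
    · refine ⟨⟨s, ⟨hs0', le_rfl⟩, rhoS_self hs0' hs1⟩, ?_⟩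
      rintro _ ⟨r, hr, rfl⟩
      exact (forall_rhoS_le_iff hL1 hδ0 hc hs0' hs.2).2 hQ r hr
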